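/- Codes. Let $[N]=\{1,\dots,N\}$ and let $\log$ be the base-2 logarithm. A \emph{strong stuck-at code of length $N$ with $\ell$ bits of errorless side information} consists of finite message sets $\mathcal M_1,\dots,\mathcal M_N$, of encoders $E_i$ ($i\in[N]$) that map a cover vector $v\in\{0,1\}^N$, a set $F\subseteq[N]$ of exactly $i$ frozen coordinates and a message $m\in\mathcal M_i$ to a pair $(w,u)\in\{0,1\}^N\times\{0,1\}^{\ell}$, and of a decoder $D:\{0,1\}^N\times\{0,1\}^{\ell}\to\bigcup_i\mathcal M_i$, such that whenever $E_i(v,F,m)=(w,u)$ we have $w_j=v_j$ for all $j\in F$, and $D(w,u)=m$. (The decoder knows neither $F$ nor $|F|$; the $\ell$ bits $u$ reach it without errors.) The code is \emph{$\varepsilon$-gapped} if for every $\rho\in(0,1-\varepsilon)$ with $\rho N\in[N]$ its rate $\frac{\log|\mathcal M_{\rho N}|}{N}$ is at least $1-\rho-\varepsilon$. Theorem. There are absolute constants $K,A,L,d$ such that for every $0<\varepsilon<1$ there exist an integer $N(\varepsilon)$ and two deterministic algorithms, an encoder and a decoder (fixed programs, depending on $\varepsilon$ but not on $N$, for a random access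 machine with logarithmic cost), such that for every $N>N(\varepsilon)$ there is an $\varepsilon$-gapped strong stuck-at code of length $N$ with $\ell$ bits of errorless side information, in which each $\mathcal M_i$ is the set $\{0,1\}^{k_i}$ of all bit strings of some length $k_i$, and such that 1. the encoder transmits $\ell\le K\cdot\frac1\varepsilon\log N$ bits to the decoder in the errorless transmission; 2. the encoding algorithm computes $E_i(v,F,m)$ from $(v,F,m)$, for all $i\in[N]$, $v$, $F$ with $|F|=i$ and $m\in\mathcal M_i$, in time at most $N^{A/\varepsilon}$, and the decoding algorithm computes $D(w,u)$ from $(w,u)$, for all $w\in\{0,1\}^N$ and $u\in\{0,1\}^\ell$, in time at most $L\cdot N\cdot(\log N)^d$. -/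

import Mathlib

/-! ### Strong stuck-at codes with errorless side information -/

/-- A strong stuck-at code of length `N` in which the encoder may also transmit `ℓ` bits to the
decoder without errors (`ℓ = 0` is the case without side information). For every `i ∈ [N]` there
is a finite set of messages `msg i` and an encoder `enc i`, whose inputs are a cover vector, a set
of exactly `i` frozen coordinates and a message of `msg i`, and whose outputs are the stored vector
and the transmitted bits. The decoder sees only the stored vector and the transmitted bits; it is
given neither the frozen coordinates nor their number. -/
structure StrongStuckAtCode (α : Type*) (N ℓ : ℕ) where
  msg : Finset.Icc 1 N → Finset α
  enc : (i : Finset.Icc 1 N) → (Fin N → Bool) → {F : Finset (Fin N) // F.card = (i : ℕ)} →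
    {m : α // m ∈ msg i} → (Fin N → Bool) × (Fin ℓ → Bool)
  dec : (Fin N → Bool) → (Fin ℓ → Bool) → {m : α // ∃ i, m ∈ msg i}
  consistent : ∀ i v F m, ∀ j ∈ F.1, (enc i v F m).1 j = v j
  decodable : ∀ i v F m, (dec (enc i v F m).1 (enc i v F m).2 : α) = m

namespace StrongStuckAtCode

/-- The rate `log₂ |M_i| / N` at defect fraction `i / N`. -/
noncomputable def rate {α : Type*} {N ℓ : ℕ} (c : StrongStuckAtCode α N ℓ)
    (i : Finset.Icc 1 N) : ℝ :=
  Real.logb 2 ((c.msg i).card : ℝ) / (N : ℝ)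

/-- The code is `ε`-gapped: for every defect fraction `ρ ∈ (0, 1 - ε)` (so that `ρ N` is an
integer `i`), the rate at `ρ` is at least `1 - ρ - ε`. -/
def IsGapped {α : Type*} {N ℓ : ℕ} (c : StrongStuckAtCode α N ℓ) (ε : ℝ) : Prop :=
  ∀ ρ : ℝ, 0 < ρ → ρ < 1 - ε → ∀ i : Finset.Icc 1 N, ((i : ℕ) : ℝ) = ρ * (N : ℝ) →
    1 - ρ - ε ≤ c.rate i

end StrongStuckAtCode

/-! ### Random access machines with logarithmic cost

Structured programs over natural numbers. A state has registers and finitely many relevant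
arrays; a program is a fixed finite text, and every operation is charged the number of bits of
the numbers it handles (addresses included). -/

namespace RAM

/-- The contents of the registers and of the arrays (`mem a j` is entry `j` of array `a`). -/
structure State where
  reg : ℕ → ℕ
  mem : ℕ → ℕ → ℕ

/-- The binary operations of the machine. -/
inductive Op
  | add | sub | mul | div | mod | land | xor | eq | lt

/-- Subtraction is truncated, `x / 0 = 0`, `x % 0 = x`, and tests return `0` or `1`. -/
def Op.eval : Op → ℕ → ℕ → ℕ
  | .add, x, y => x + y
  | .sub, x, y => x - y
  | .mul, x, y => x * y
  | .div, x, y => x / y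
  | .mod, x, y => x % y
  | .land, x, y => Nat.land x y
  | .xor, x, y => Nat.xor x y
  | .eq, x, y => if x = y then 1 else 0
  | .lt, x, y => if x < y then 1 else 0

/-- Expressions: constants, registers, array entries with a computed index, operations. -/
inductive Expr
  | const (n : ℕ)
  | reg (x : ℕ)
  | load (a : ℕ) (idx : Expr)
  | op (o : Op) (e₁ e₂ : Expr)

/-- The value of an expression. -/
def Expr.eval (σ : State) : Expr → ℕ
  | .const n => n
  | .reg x => σ.reg x
  | .load a idx => σ.mem a (idx.eval σ)
  | .op o e₁ e₂ => o.eval (e₁.eval σ) (e₂.eval σ)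

/-- The cost of evaluating an expression; `Nat.size n` is the number of bits of `n`. -/
def Expr.cost (σ : State) : Expr → ℕ
  | .const n => 1 + n.size
  | .reg x => 1 + x.size + (σ.reg x).size
  | .load a idx =>
      idx.cost σ + (1 + a.size + (idx.eval σ).size + (σ.mem a (idx.eval σ)).size)
  | .op _ e₁ e₂ => e₁.cost σ + e₂.cost σ + (1 + (e₁.eval σ).size + (e₂.eval σ).size)

/-- Programs: `assign x e` is `x := e`, `store a idx e` is `a[idx] := e`, and `cond`, `loop` are
if-then-else and while, where a nonzero value counts as true. -/
inductive Prog
  | skip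
  | assign (x : ℕ) (e : Expr)
  | store (a : ℕ) (idx e : Expr)
  | seq (p q : Prog)
  | cond (b : Expr) (p q : Prog)
  | loop (b : Expr) (p : Prog)

/-- The state after writing `n` into register `x`. -/
def State.setReg (σ : State) (x n : ℕ) : State :=
  { σ with reg := Function.update σ.reg x n }

/-- The state after writing `n` into entry `j` of array `a`. -/
def State.setMem (σ : State) (a j n : ℕ) : State :=
  { σ with mem := Function.update σ.mem a (Function.update (σ.mem a) j n) }

/-- `Exec p σ t τ`: program `p`, started in `σ`, halts in `τ` after time exactly `t`. -/
inductive Exec : Prog → State → ℕ → State → Prop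
  | skip (σ : State) : Exec .skip σ 1 σ
  | assign (σ : State) (x : ℕ) (e : Expr) :
      Exec (.assign x e) σ (e.cost σ + (1 + x.size + (e.eval σ).size)) (σ.setReg x (e.eval σ))
  | store (σ : State) (a : ℕ) (idx e : Expr) :
      Exec (.store a idx e) σ
        (idx.cost σ + e.cost σ + (1 + a.size + (idx.eval σ).size + (e.eval σ).size))
        (σ.setMem a (idx.eval σ) (e.eval σ))
  | seq {p q : Prog} {σ τ υ : State} {s t : ℕ} :
      Exec p σ s τ → Exec q τ t υ → Exec (.seq p q) σ (s + t) υ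
  | cond_true {b : Expr} {p : Prog} (q : Prog) {σ τ : State} {t : ℕ} :
      b.eval σ ≠ 0 → Exec p σ t τ → Exec (.cond b p q) σ (b.cost σ + 1 + t) τ
  | cond_false {b : Expr} (p : Prog) {q : Prog} {σ τ : State} {t : ℕ} :
      b.eval σ = 0 → Exec q σ t τ → Exec (.cond b p q) σ (b.cost σ + 1 + t) τ
  | loop_false {b : Expr} (p : Prog) {σ : State} :
      b.eval σ = 0 → Exec (.loop b p) σ (b.cost σ + 1) σ
  | loop_true {b : Expr} {p : Prog} {σ τ υ : State} {s t : ℕ} :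
      b.eval σ ≠ 0 → Exec p σ s τ → Exec (.loop b p) τ t υ →
        Exec (.loop b p) σ (b.cost σ + 1 + s + t) υ

/-- The start state on a tuple of bit strings: array `k` holds the bits of the `k`-th string,
register `k` holds its length, and everything else is zero. -/
def startState (xs : List (List Bool)) : State where
  reg k := (xs.getD k []).length
  mem k j := ((xs.getD k []).getD j false).toNat

/-- The state shows the tuple `ys`: for each `k`, register `k` holds the length of the `k`-th
string, and array `k` begins with its bits. -/
def State.Shows (σ : State) (ys : List (List Bool)) : Prop :=
  ∀ k < ys.length, σ.reg k = (ys.getD k []).length ∧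
    ∀ j < (ys.getD k []).length, σ.mem k j = ((ys.getD k []).getD j false).toNat

/-- On input `xs`, the program halts with output `ys` within time `T`. -/
def RunsInTime (p : Prog) (xs ys : List (List Bool)) (T : ℝ) : Prop :=
  ∃ (t : ℕ) (τ : State), Exec p (startState xs) t τ ∧ τ.Shows ys ∧ (t : ℝ) ≤ T

end RAM

/-- The program computes all the encoders of the code, within time `T`: its inputs are the cover
vector, the characteristic vector of the set of frozen coordinates, and the message; its outputs
are the stored vector and the transmitted bits. -/
def StrongStuckAtCode.EncodedBy {N ℓ : ℕ} (c : StrongStuckAtCode (List Bool) N ℓ)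
    (p : RAM.Prog) (T : ℝ) : Prop :=
  ∀ i v F (m : {m : List Bool // m ∈ c.msg i}), RAM.RunsInTime p
    [List.ofFn v, List.ofFn (fun j : Fin N => decide (j ∈ F.1)), m.1]
    [List.ofFn (c.enc i v F m).1, List.ofFn (c.enc i v F m).2] T

/-- The program computes the decoder of the code, within time `T`, on all its inputs. -/
def StrongStuckAtCode.DecodedBy {N ℓ : ℕ} (c : StrongStuckAtCode (List Bool) N ℓ)
    (p : RAM.Prog) (T : ℝ) : Prop :=
  ∀ w u, RAM.RunsInTime p [List.ofFn w, List.ofFn u] [(c.dec w u).1] T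

namespace RAM

/-! ### A program logic with step counts -/

/-! Let `t` be the binary length of `N`, `q = ⌈1/ε⌉`, and cut the cells into `n = N / b` blocks of
length `b = 6 * q * t`. A block stores data as a linear hash of its content. The hash matrix over
the field of two elements is Hankel, with entry `A (i + j)`, so one seed of `2 * b` bits serves
every block and every number of rows. A block with `f` free cells can be given any `f - t` hash bits
by changing free cells only, provided that the `f - t` rows are independent on the free columns. For
a fixed nonzero combination of rows, its last nonzero coefficient turns the dependence on the seed
into a triangular system, so the combination vanishes on the free columns for exactly a fraction
`2^(-f)` of the seeds (`hankelCombination_surjective`, `card_ker_hankelCombination`). A union bound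
over at most `2^(f - t)` combinations and `n < 2^t` blocks leaves a seed that is good for all blocks
(`exists_surjective_hankel`, `exists_seed`).

The decoder does not know the numbers `f`. Therefore the blocks with `f > 3 * t` form a linked list:
the first `2 * t` hash bits of such a block describe the previous one (its index, its number of hash
bits, its position in the message), and the other `f - 3 * t` hash bits carry message bits. The side
information is the seed, the description of the last block in the list, and the number of frozen
cells minus one: `2 * b + 3 * t` bits. The decoder follows the list backwards
(`decodeStep_iterate`).

Every block loses at most `3 * t` cells, which is a fraction `1 / (2 * q)` of its length, and fewer
than `b` cells lie outside the blocks; for large `N` the total loss is at most `N / q ≤ ε * N`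
(`le_blockChain_snd_of_count`, `StrongStuckAtCode.isGapped_of_card`).

The encoder searches all `2^(2 * b)` seeds and, for each block, all `2^b` contents, in time
`N^(O(1/ε))`; the decoder makes `n` steps of `O(b^2)` operations. Logarithmic cost is handled by the
program logic `Runs`: it counts steps, and a step costs at most a constant of the program times the
word length `B`, here `4 * b`. These constants depend on `ε`, and large `N` absorbs them. -/

@[simp] theorem State.setReg_reg (σ : State) (x n y : ℕ) :
    (σ.setReg x n).reg y = if y = x then n else σ.reg y := by
  simp [State.setReg, Function.update_apply]

@[simp] theorem State.setReg_mem (σ : State) (x n : ℕ) : (σ.setReg x n).mem = σ.mem := rfl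

@[simp] theorem State.setMem_reg (σ : State) (a j n : ℕ) : (σ.setMem a j n).reg = σ.reg := rfl

@[simp] theorem State.setMem_mem (σ : State) (a j n a' : ℕ) :
    (σ.setMem a j n).mem a' =
      if a' = a then Function.update (σ.mem a) j n else σ.mem a' := by
  simp [State.setMem, Function.update_apply]

instance : Add Expr := ⟨Expr.op .add⟩
instance : Sub Expr := ⟨Expr.op .sub⟩
instance : Mul Expr := ⟨Expr.op .mul⟩
instance : Div Expr := ⟨Expr.op .div⟩
instance : Mod Expr := ⟨Expr.op .mod⟩

section eval
variable (σ : State) (e f : Expr)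

@[simp] theorem Expr.eval_const (n : ℕ) : (Expr.const n).eval σ = n := rfl
@[simp] theorem Expr.eval_reg (x : ℕ) : (Expr.reg x).eval σ = σ.reg x := rfl
@[simp] theorem Expr.eval_load (a : ℕ) : (Expr.load a e).eval σ = σ.mem a (e.eval σ) := rfl
@[simp] theorem Expr.eval_add : (e + f).eval σ = e.eval σ + f.eval σ := rfl
@[simp] theorem Expr.eval_sub : (e - f).eval σ = e.eval σ - f.eval σ := rfl
@[simp] theorem Expr.eval_mul : (e * f).eval σ = e.eval σ * f.eval σ := rfl
@[simp] theorem Expr.eval_div : (e / f).eval σ = e.eval σ / f.eval σ := rfl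
@[simp] theorem Expr.eval_mod : (e % f).eval σ = e.eval σ % f.eval σ := rfl
@[simp] theorem Expr.eval_eq :
    (Expr.op .eq e f).eval σ = if e.eval σ = f.eval σ then 1 else 0 := rfl
@[simp] theorem Expr.eval_lt :
    (Expr.op .lt e f).eval σ = if e.eval σ < f.eval σ then 1 else 0 := rfl

end eval

/-- The power of an expression with a constant exponent. -/
def Expr.powConst (e : Expr) : ℕ → Expr
  | 0 => .const 1
  | n + 1 => e.powConst n * e

@[simp] theorem Expr.eval_powConst (σ : State) (e : Expr) (n : ℕ) :
    (e.powConst n).eval σ = e.eval σ ^ n := by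
  induction n with
  | zero => rfl
  | succ n ih => simp [Expr.powConst, ih, pow_succ]

/-- All numbers in the state have at most `B` bits. -/
def State.Bounded (B : ℕ) (σ : State) : Prop :=
  (∀ x, σ.reg x < 2 ^ B) ∧ ∀ a j, σ.mem a j < 2 ^ B

theorem State.Bounded.setReg {B : ℕ} {σ : State} (h : σ.Bounded B) (x : ℕ) {n : ℕ}
    (hn : n < 2 ^ B) : (σ.setReg x n).Bounded B := by
  refine ⟨fun y => ?_, h.2⟩
  rw [State.setReg_reg]
  split_ifs
  · exact hn
  · exact h.1 y

theorem State.Bounded.setMem {B : ℕ} {σ : State} (h : σ.Bounded B) (a j : ℕ) {n : ℕ}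
    (hn : n < 2 ^ B) : (σ.setMem a j n).Bounded B := by
  refine ⟨h.1, fun a' j' => ?_⟩
  rw [State.setMem_mem]
  split_ifs
  · rw [Function.update_apply]
    split_ifs
    · exact hn
    · exact h.2 _ _
  · exact h.2 _ _

/-- A bound for the size of the value, per bit of the state. -/
def Expr.sizeWeight : Expr → ℕ
  | .const n => n.size
  | .reg _ => 1
  | .load _ _ => 1
  | .op _ e f => e.sizeWeight + f.sizeWeight + 1

/-- A bound for the cost of evaluation, per bit of the state. -/
def Expr.costWeight : Expr → ℕ
  | .const n => 1 + n.size
  | .reg x => 2 + x.size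
  | .load a idx => idx.costWeight + (2 + a.size + idx.sizeWeight)
  | .op _ e f => e.costWeight + f.costWeight + (1 + e.sizeWeight + f.sizeWeight)

/-- Multiplication is the worst case, where the bit lengths add; the extra bit is for the carry of
an addition. -/
theorem Op.eval_lt_two_pow (o : Op) {x y X Y : ℕ} (hx : x < 2 ^ X) (hy : y < 2 ^ Y) :
    o.eval x y < 2 ^ (X + Y + 1) := by
  have hX : 2 ^ X ≤ 2 ^ (X + Y) := Nat.pow_le_pow_right (by norm_num) (by omega)
  have hY : 2 ^ Y ≤ 2 ^ (X + Y) := Nat.pow_le_pow_right (by norm_num) (by omega)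
  have hpos : 0 < 2 ^ X := by positivity
  rw [pow_succ]
  cases o with
  | add => simp only [Op.eval]; omega
  | sub => simp only [Op.eval]; omega
  | mul =>
    have : x * y < 2 ^ X * 2 ^ Y := Nat.mul_lt_mul'' hx hy
    rw [← pow_add] at this
    simp only [Op.eval]; omega
  | div => simp only [Op.eval]; have := Nat.div_le_self x y; omega
  | mod => simp only [Op.eval]; have := Nat.mod_le x y; omega
  | land => simp only [Op.eval]; have : Nat.land x y ≤ x := Nat.and_le_left; omega
  | xor =>
    simp only [Op.eval]
    have : Nat.xor x y < 2 ^ (X + Y) := Nat.xor_lt_two_pow (by omega) (by omega)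
    omega
  | eq => simp only [Op.eval]; split_ifs <;> omega
  | lt => simp only [Op.eval]; split_ifs <;> omega

/-- Only stored values have to fit into `B` bits. Intermediate values inside an expression may be
longer, but only by a factor that depends on the text of the expression. -/
theorem Expr.eval_lt_two_pow {B : ℕ} (hB : 1 ≤ B) {σ : State} (h : σ.Bounded B) (e : Expr) :
    e.eval σ < 2 ^ (e.sizeWeight * B) := by
  induction e with
  | const n =>
    refine (Nat.lt_size_self n).trans_le (Nat.pow_le_pow_right (by norm_num) ?_)
    exact Nat.le_mul_of_pos_right _ hB
  | reg x => simpa [Expr.sizeWeight] using h.1 x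
  | load a e _ => simpa [Expr.sizeWeight] using h.2 a _
  | op o e f he hf =>
    refine (Op.eval_lt_two_pow o he hf).trans_le (Nat.pow_le_pow_right (by norm_num) ?_)
    simp only [Expr.sizeWeight]
    nlinarith

theorem Expr.size_eval_le {B : ℕ} (hB : 1 ≤ B) {σ : State} (h : σ.Bounded B) (e : Expr) :
    (e.eval σ).size ≤ e.sizeWeight * B :=
  Nat.size_le.2 (e.eval_lt_two_pow hB h)

theorem Expr.cost_le {B : ℕ} (hB : 1 ≤ B) {σ : State} (h : σ.Bounded B) (e : Expr) :
    e.cost σ ≤ e.costWeight * B := by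
  induction e with
  | const n => exact Nat.le_mul_of_pos_right _ hB
  | reg x =>
    have := Nat.size_le.2 (h.1 x)
    simp only [Expr.cost, Expr.costWeight]
    nlinarith [Nat.zero_le x.size]
  | load a e he =>
    have h1 := Nat.size_le.2 (h.2 a (e.eval σ))
    have h2 := e.size_eval_le hB h
    simp only [Expr.cost, Expr.costWeight]
    nlinarith [Nat.zero_le a.size]
  | op o e f he hf =>
    have h1 := e.size_eval_le hB h
    have h2 := f.size_eval_le hB h
    simp only [Expr.cost, Expr.costWeight]
    nlinarith

/-- A bound for the cost of one step, per bit of the state. -/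
def Prog.weight : Prog → ℕ
  | .skip => 1
  | .assign x e => e.costWeight + (2 + x.size)
  | .store a idx e => idx.costWeight + e.costWeight + (2 + a.size + idx.sizeWeight)
  | .seq p q => p.weight + q.weight
  | .cond b p q => b.costWeight + 1 + p.weight + q.weight
  | .loop b p => b.costWeight + 1 + p.weight

/-- Does the program write into register `x`? -/
def Prog.writesReg : Prog → ℕ → Bool
  | .skip, _ => false
  | .assign y _, x => decide (x = y)
  | .store _ _ _, _ => false
  | .seq p q, x => p.writesReg x || q.writesReg x
  | .cond _ p q, x => p.writesReg x || q.writesReg x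
  | .loop _ p, x => p.writesReg x

/-- Does the program write into array `a`? -/
def Prog.writesMem : Prog → ℕ → Bool
  | .skip, _ => false
  | .assign _ _, _ => false
  | .store a' _ _, a => decide (a = a')
  | .seq p q, a => p.writesMem a || q.writesMem a
  | .cond _ p q, a => p.writesMem a || q.writesMem a
  | .loop _ p, a => p.writesMem a

/-- `τ` differs from `σ` only where `p` writes. -/
def Prog.Frame (p : Prog) (σ τ : State) : Prop :=
  (∀ x, p.writesReg x = false → τ.reg x = σ.reg x) ∧
    ∀ a, p.writesMem a = false → τ.mem a = σ.mem a

/-- This syntactic frame property keeps loop invariants short: registers and arrays that a program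
text never writes need not be mentioned in them. -/
theorem Exec.frame {p : Prog} {σ τ : State} {t : ℕ} (h : Exec p σ t τ) : p.Frame σ τ := by
  induction h with
  | skip σ => exact ⟨fun _ _ => rfl, fun _ _ => rfl⟩
  | assign σ x e =>
    refine ⟨fun y hy => ?_, fun _ _ => rfl⟩
    simp only [Prog.writesReg, decide_eq_false_iff_not] at hy
    simp [hy]
  | store σ a idx e =>
    refine ⟨fun y hy => rfl, fun a' ha => ?_⟩
    simp only [Prog.writesMem, decide_eq_false_iff_not] at ha
    simp [ha]
  | seq _ _ ih₁ ih₂ =>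
    refine ⟨fun y hy => ?_, fun a ha => ?_⟩
    · simp only [Prog.writesReg, Bool.or_eq_false_iff] at hy
      rw [ih₂.1 y hy.2, ih₁.1 y hy.1]
    · simp only [Prog.writesMem, Bool.or_eq_false_iff] at ha
      rw [ih₂.2 a ha.2, ih₁.2 a ha.1]
  | cond_true q _ _ ih =>
    refine ⟨fun y hy => ?_, fun a ha => ?_⟩
    · simp only [Prog.writesReg, Bool.or_eq_false_iff] at hy
      exact ih.1 y hy.1
    · simp only [Prog.writesMem, Bool.or_eq_false_iff] at ha
      exact ih.2 a ha.1
  | cond_false q _ _ ih =>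
    refine ⟨fun y hy => ?_, fun a ha => ?_⟩
    · simp only [Prog.writesReg, Bool.or_eq_false_iff] at hy
      exact ih.1 y hy.2
    · simp only [Prog.writesMem, Bool.or_eq_false_iff] at ha
      exact ih.2 a ha.2
  | loop_false p _ => exact ⟨fun _ _ => rfl, fun _ _ => rfl⟩
  | loop_true _ _ _ ih₁ ih₂ =>
    exact ⟨fun y hy => (ih₂.1 y hy).trans (ih₁.1 y hy),
      fun a ha => (ih₂.2 a ha).trans (ih₁.2 a ha)⟩

/-- Started in `σ`, the program halts within `k` steps, on numbers of at most `B` bits, in a state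
that satisfies `Q`. -/
def Runs (B : ℕ) (p : Prog) (σ : State) (k : ℕ) (Q : State → Prop) : Prop :=
  1 ≤ B → σ.Bounded B →
    ∃ t τ, Exec p σ t τ ∧ t ≤ k * (p.weight * B) ∧ τ.Bounded B ∧ Q τ

/-! ### Hoare rules with step counts -/

section rules
variable {B : ℕ} {p q : Prog} {σ : State} {k l : ℕ} {Q R : State → Prop}

/-- The word bound on the initial state is built into `Runs`; this makes it available for bounding
the values of registers inside a proof. -/
theorem Runs.of_bounded (h : 1 ≤ B → σ.Bounded B → Runs B p σ k Q) : Runs B p σ k Q :=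
  fun h1 h2 => h h1 h2 h1 h2

theorem Runs.mono (h : Runs B p σ k R) (hkl : k ≤ l)
    (hQ : ∀ τ, R τ → p.Frame σ τ → Q τ) : Runs B p σ l Q := fun hB hσ => by
  obtain ⟨t, τ, he, ht, hb, hr⟩ := h hB hσ
  exact ⟨t, τ, he, ht.trans (Nat.mul_le_mul_right _ hkl), hb, hQ τ hr he.frame⟩

theorem Runs.le (h : Runs B p σ k Q) (hkl : k ≤ l) : Runs B p σ l Q :=
  h.mono hkl fun _ h _ => h

theorem Runs.skip (h : Q σ) : Runs B .skip σ 1 Q := fun hB hσ =>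
  ⟨1, σ, .skip σ, by simpa [Prog.weight] using hB, hσ, h⟩

theorem Runs.assign {x v : ℕ} {e : Expr} (he : e.eval σ = v) (hv : v < 2 ^ B)
    (h : Q (σ.setReg x v)) : Runs B (.assign x e) σ 1 Q := fun hB hσ => by
  subst he
  refine ⟨_, _, .assign σ x e, ?_, hσ.setReg x hv, h⟩
  have h1 := e.cost_le hB hσ
  have h2 := Nat.size_le.2 hv
  simp only [Prog.weight]
  nlinarith [Nat.zero_le x.size]

theorem Runs.store {a j v : ℕ} {idx e : Expr} (hj : idx.eval σ = j) (he : e.eval σ = v)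
    (hv : v < 2 ^ B) (h : Q (σ.setMem a j v)) : Runs B (.store a idx e) σ 1 Q := fun hB hσ => by
  subst he hj
  refine ⟨_, _, .store σ a idx e, ?_, hσ.setMem a _ hv, h⟩
  have h1 := e.cost_le hB hσ
  have h2 := Nat.size_le.2 hv
  have h3 := idx.cost_le hB hσ
  have h4 := idx.size_eval_le hB hσ
  simp only [Prog.weight]
  nlinarith [Nat.zero_le a.size]

theorem Runs.seq (hp : Runs B p σ k R) (hq : ∀ τ, R τ → p.Frame σ τ → Runs B q τ l Q) :
    Runs B (.seq p q) σ (k + l) Q := fun hB hσ => by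
  obtain ⟨t, τ, he, ht, hb, hr⟩ := hp hB hσ
  obtain ⟨s, υ, he', hs, hb', hq⟩ := hq τ hr he.frame hB hb
  refine ⟨_, _, .seq he he', ?_, hb', hq⟩
  simp only [Prog.weight]
  calc t + s ≤ k * (p.weight * B) + l * (q.weight * B) := add_le_add ht hs
    _ ≤ k * ((p.weight + q.weight) * B) + l * ((p.weight + q.weight) * B) := by
      gcongr <;> omega
    _ = _ := by ring

theorem Runs.assign_seq {x v : ℕ} {e : Expr} (he : e.eval σ = v) (hv : v < 2 ^ B)
    (h : Runs B q (σ.setReg x v) l Q) : Runs B (.seq (.assign x e) q) σ (1 + l) Q :=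
  Runs.seq (R := fun τ => τ = σ.setReg x v) (Runs.assign he hv rfl) fun _ h' _ => h' ▸ h

theorem Runs.store_seq {a j v : ℕ} {idx e : Expr} (hj : idx.eval σ = j) (he : e.eval σ = v)
    (hv : v < 2 ^ B) (h : Runs B q (σ.setMem a j v) l Q) :
    Runs B (.seq (.store a idx e) q) σ (1 + l) Q :=
  Runs.seq (R := fun τ => τ = σ.setMem a j v) (Runs.store hj he hv rfl) fun _ h' _ => h' ▸ h

theorem Runs.cond {b : Expr} (hp : b.eval σ ≠ 0 → Runs B p σ k Q)
    (hq : b.eval σ = 0 → Runs B q σ k Q) : Runs B (.cond b p q) σ (k + 1) Q := fun hB hσ => by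
  have h1 := b.cost_le hB hσ
  by_cases hb : b.eval σ = 0
  · obtain ⟨t, τ, he, ht, hb', hr⟩ := hq hb hB hσ
    refine ⟨_, τ, .cond_false p hb he, ?_, hb', hr⟩
    simp only [Prog.weight]
    nlinarith [Nat.zero_le (k * (b.costWeight * B)), Nat.zero_le (k * B),
      Nat.zero_le (k * (p.weight * B)), Nat.zero_le (p.weight * B), Nat.zero_le (q.weight * B)]
  · obtain ⟨t, τ, he, ht, hb', hr⟩ := hp hb hB hσ
    refine ⟨_, τ, .cond_true q hb he, ?_, hb', hr⟩
    simp only [Prog.weight]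
    nlinarith [Nat.zero_le (k * (b.costWeight * B)), Nat.zero_le (k * B),
      Nat.zero_le (k * (q.weight * B)), Nat.zero_le (p.weight * B), Nat.zero_le (q.weight * B)]

/-- The invariant carries the number `k` of completed rounds. Termination comes from the demand that
a true guard forces `k < K`; the induction is on the number of rounds left. -/
theorem Runs.loop {b : Expr} (I : ℕ → State → Prop) (K : ℕ)
    (h0 : I 0 σ)
    (hbody : ∀ k τ, I k τ → p.Frame σ τ → b.eval τ ≠ 0 → k < K ∧ Runs B p τ l (I (k + 1))) :
    Runs B (.loop b p) σ (K * (l + 1) + 1) (fun τ => b.eval τ = 0 ∧ ∃ k ≤ K, I k τ) := by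
  intro hB hσ
  have main : ∀ d k τ, k + d = K → I k τ → τ.Bounded B → p.Frame σ τ →
      ∃ t υ, Exec (.loop b p) τ t υ ∧ t ≤ (d * (l + 1) + 1) * ((Prog.loop b p).weight * B) ∧
        υ.Bounded B ∧ b.eval υ = 0 ∧ ∃ k ≤ K, I k υ := by
    intro d
    induction d with
    | zero =>
      intro k τ hk hI hb hf
      have hz : b.eval τ = 0 := by
        by_contra hz
        have := (hbody k τ hI hf hz).1
        omega
      refine ⟨_, τ, .loop_false p hz, ?_, hb, hz, k, by omega, hI⟩
      have h1 := b.cost_le hB hb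
      simp only [Prog.weight]
      nlinarith [Nat.zero_le (p.weight * B)]
    | succ d ih =>
      intro k τ hk hI hb hf
      have h1 := b.cost_le hB hb
      by_cases hz : b.eval τ = 0
      · refine ⟨_, τ, .loop_false p hz, ?_, hb, hz, k, by omega, hI⟩
        simp only [Prog.weight]
        nlinarith [Nat.zero_le (p.weight * B),
          Nat.zero_le ((d + 1) * (l + 1) * ((b.costWeight + 1 + p.weight) * B))]
      · obtain ⟨t, υ, he, ht, hb', hI'⟩ := (hbody k τ hI hf hz).2 hB hb
        have hf' : p.Frame σ υ :=
          ⟨fun x hx => (he.frame.1 x hx).trans (hf.1 x hx),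
            fun a ha => (he.frame.2 a ha).trans (hf.2 a ha)⟩
        obtain ⟨s, ω, he', hs, hb'', hq⟩ := ih (k + 1) υ (by omega) hI' hb' hf'
        refine ⟨_, ω, .loop_true hz he he', ?_, hb'', hq⟩
        simp only [Prog.weight] at hs ⊢
        nlinarith [Nat.zero_le (p.weight * B), Nat.zero_le (l * (b.costWeight * B)),
          Nat.zero_le (l * B)]
  obtain ⟨t, τ, h1, h2, h3, h4⟩ := main K 0 σ (by omega) h0 hσ ⟨fun _ _ => rfl, fun _ _ => rfl⟩
  exact ⟨t, τ, h1, h2, h3, h4⟩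

/-- `for x < e do p`. -/
def Prog.forLt (x : ℕ) (e : Expr) (p : Prog) : Prog :=
  .seq (.assign x (.const 0))
    (.loop (.op .lt (.reg x) e) (.seq p (.assign x (.reg x + .const 1))))

/-- Each round costs two steps besides the body, for the guard and the increment, and two more are
spent at the start and at the final test. The body has to establish the invariant for the state
after the increment. -/
theorem Runs.forLt {x : ℕ} {e : Expr} (I : ℕ → State → Prop) (K : ℕ) (hK : K < 2 ^ B)
    (h0 : I 0 (σ.setReg x 0))
    (he : ∀ k τ, I k τ → τ.reg x = k → (Prog.forLt x e p).Frame σ τ → e.eval τ = K)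
    (hbody : ∀ k < K, ∀ τ, I k τ → τ.reg x = k → (Prog.forLt x e p).Frame σ τ →
      Runs B p τ l (fun υ => υ.reg x = k ∧ I (k + 1) (υ.setReg x (k + 1)))) :
    Runs B (Prog.forLt x e p) σ (K * (l + 2) + 2) (fun τ => τ.reg x = K ∧ I K τ) := by
  have hfr : ∀ {τ}, (Prog.seq p (.assign x (.reg x + .const 1))).Frame (σ.setReg x 0) τ →
      (Prog.forLt x e p).Frame σ τ := by
    intro τ h
    refine ⟨fun y hy => ?_, fun a ha => ?_⟩
    · simp only [Prog.forLt, Prog.writesReg, Bool.or_eq_false_iff,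
        decide_eq_false_iff_not] at hy
      rw [h.1 y (by simp [Prog.writesReg, hy])]
      simp [hy.1]
    · simp only [Prog.forLt, Prog.writesMem, Bool.or_eq_false_iff] at ha
      rw [h.2 a (by simp [Prog.writesMem, ha])]
      simp
  have h1 : Runs B (Prog.forLt x e p) σ (1 + (K * (l + 1 + 1) + 1)) _ :=
    Runs.assign_seq (v := 0) rfl (by positivity)
      (Runs.loop (fun k τ => k ≤ K ∧ τ.reg x = k ∧ I k τ) K ⟨by omega, by simp, h0⟩ (by
        intro k τ hI hf hz
        have hev := he k τ hI.2.2 hI.2.1 (hfr hf)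
        have hk : k < K := by
          simp only [Expr.eval_lt, Expr.eval_reg, hev, hI.2.1] at hz
          by_contra hc
          simp [hc] at hz
        refine ⟨hk, Runs.seq (hbody k hk τ hI.2.2 hI.2.1 (hfr hf)) ?_⟩
        intro υ hυ _
        exact Runs.assign (v := k + 1) (by simp [hυ.1]) (by omega)
          ⟨by omega, by simp, hυ.2⟩))
  refine Runs.mono h1 (by ring_nf; omega) ?_
  rintro τ ⟨hz, k, hk, hk', hx, hI⟩ hf
  have hev := he k τ hI hx hf
  have : k = K := by
    simp only [Expr.eval_lt, Expr.eval_reg, hev, hx] at hz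
    by_contra hc
    have : k < K := by omega
    simp [this] at hz
  subst this
  exact ⟨hx, hI⟩

end rules

end RAM

/-! ### Numbers as bit strings -/

/-- The number with the binary digits `M off, M (off + 1), …, M (off + len - 1)`. -/
def bitsNum (M : ℕ → ℕ) (off len : ℕ) : ℕ := ∑ j ∈ Finset.range len, M (off + j) * 2 ^ j

theorem bitsNum_succ (M : ℕ → ℕ) (off len : ℕ) :
    bitsNum M off (len + 1) = bitsNum M off len + M (off + len) * 2 ^ len :=
  Finset.sum_range_succ _ _

theorem bitsNum_congr {M M' : ℕ → ℕ} {off off' len : ℕ}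
    (h : ∀ j < len, M (off + j) = M' (off' + j)) : bitsNum M off len = bitsNum M' off' len :=
  Finset.sum_congr rfl fun j hj => by rw [h j (Finset.mem_range.1 hj)]

theorem bitsNum_lt {M : ℕ → ℕ} {off len : ℕ} (h : ∀ j < len, M (off + j) ≤ 1) :
    bitsNum M off len < 2 ^ len := by
  induction len with
  | zero => simp [bitsNum]
  | succ n ih =>
    rw [bitsNum_succ, pow_succ]
    have h1 := ih fun j hj => h j (by omega)
    have h2 : M (off + n) * 2 ^ n ≤ 1 * 2 ^ n := Nat.mul_le_mul_right _ (h n (by omega))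
    omega

theorem bitsNum_div_mod {M : ℕ → ℕ} {off len : ℕ} (h : ∀ j < len, M (off + j) ≤ 1) {i : ℕ}
    (hi : i < len) : bitsNum M off len / 2 ^ i % 2 = M (off + i) := by
  induction len with
  | zero => omega
  | succ n ih =>
    rw [bitsNum_succ]
    have h0 : ∀ j < n, M (off + j) ≤ 1 := fun j hj => h j (by omega)
    rcases Nat.lt_succ_iff_lt_or_eq.1 hi with hi' | rfl
    · obtain ⟨d, rfl⟩ : ∃ d, n = i + 1 + d := ⟨n - (i + 1), by omega⟩
      have : M (off + (i + 1 + d)) * 2 ^ (i + 1 + d) =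
          2 ^ i * (2 * (M (off + (i + 1 + d)) * 2 ^ d)) := by ring
      rw [this, Nat.add_mul_div_left _ _ (by positivity), Nat.add_mul_mod_self_left]
      exact ih h0 hi'
    · rw [Nat.add_mul_div_right _ _ (by positivity), Nat.div_eq_of_lt (bitsNum_lt h0), zero_add,
        Nat.mod_eq_of_lt]
      have := h i (by omega)
      omega

theorem bitsNum_digits (x len : ℕ) : bitsNum (fun j => x / 2 ^ j % 2) 0 len = x % 2 ^ len := by
  induction len with
  | zero => simp [bitsNum, Nat.mod_one]
  | succ n ih => rw [bitsNum_succ, ih, Nat.mod_pow_succ]; simp only [zero_add]; ring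

theorem exists_lt_two_pow_digits (f : ℕ → ℕ) (hf : ∀ j, f j ≤ 1) (m : ℕ) :
    ∃ x < 2 ^ m, ∀ j < m, x / 2 ^ j % 2 = f j :=
  ⟨bitsNum f 0 m, bitsNum_lt fun j _ => hf _, fun j hj => by
    simpa using bitsNum_div_mod (fun j _ => hf (0 + j)) hj⟩

/-! ### Hankel hashing of blocks -/

/-- Bit `i` of the hash value, with seed `A`, of the block of length `b` of `W` at `base`. -/
def hashBit (b : ℕ) (W A : ℕ → ℕ) (base i : ℕ) : ℕ :=
  (∑ j ∈ Finset.range b, A (i + j) * W (base + j)) % 2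

/-- The first `κ` bits of the hash value, as a number. -/
def hashNum (b : ℕ) (W A : ℕ → ℕ) (base κ : ℕ) : ℕ := bitsNum (hashBit b W A base) 0 κ

theorem hashBit_le (b : ℕ) (W A : ℕ → ℕ) (base i : ℕ) : hashBit b W A base i ≤ 1 :=
  Nat.lt_succ_iff.1 (Nat.mod_lt _ two_pos)

theorem hashNum_lt (b : ℕ) (W A : ℕ → ℕ) (base κ : ℕ) : hashNum b W A base κ < 2 ^ κ :=
  bitsNum_lt fun _ _ => hashBit_le ..

/-- For `κ ≤ b` all indices `i + j` are below `2 * b`, so only the first `2 * b` cells of the seed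
array matter. This allows further side information to be stored behind the seed. -/
theorem hashNum_congr {b κ base : ℕ} {W W' A A' : ℕ → ℕ} (hκ : κ ≤ b)
    (hW : ∀ j < b, W (base + j) = W' (base + j)) (hA : ∀ j < 2 * b, A j = A' j) :
    hashNum b W A base κ = hashNum b W' A' base κ := by
  refine bitsNum_congr fun i hi => ?_
  unfold hashBit
  congr 1
  refine Finset.sum_congr rfl fun j hj => ?_
  have := Finset.mem_range.1 hj
  rw [hW j this, hA _ (by omega)]

namespace RAM

/-! ### Subroutines -/

/-- Reads `reg 21` bits of array `A`, from position `reg 20` on, as a number into `reg 22`. -/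
def packProg (A : ℕ) : Prog :=
  .seq (.assign 22 (.const 0)) (.seq (.assign 23 (.const 1))
    (.forLt 24 (.reg 21)
      (.seq (.assign 22 (.reg 22 + .load A (.reg 20 + .reg 24) * .reg 23))
        (.assign 23 (.reg 23 + .reg 23)))))

theorem runs_packProg {B A : ℕ} {σ : State} (hA : ∀ j, σ.mem A j ≤ 1) (hlen : σ.reg 21 < B) :
    Runs B (packProg A) σ (4 * σ.reg 21 + 4)
      (fun τ => τ.reg 22 = bitsNum (σ.mem A) (σ.reg 20) (σ.reg 21)) := by
  have hB : σ.reg 21 < 2 ^ B := hlen.trans Nat.lt_two_pow_self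
  have hB1 : 2 ^ (σ.reg 21 + 1) ≤ 2 ^ B := Nat.pow_le_pow_right (by norm_num) hlen
  have hB0 : 1 < 2 ^ B := Nat.one_lt_two_pow (by omega)
  refine Runs.le (Runs.assign_seq (v := 0) rfl (by omega) (Runs.assign_seq (v := 1) rfl (by omega)
    (Runs.mono (l := _) (Runs.forLt (l := 2)
      (fun k τ => τ.reg 22 = bitsNum (σ.mem A) (σ.reg 20) k ∧ τ.reg 23 = 2 ^ k)
      (σ.reg 21) hB ?_ ?_ ?_) le_rfl ?_))) (by omega)
  · simp [bitsNum]
  · intro k τ _ _ hf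
    simpa using hf.1 21 rfl
  · rintro k hk τ ⟨h22, h23⟩ h24 hf
    have h20 : τ.reg 20 = σ.reg 20 := by simpa using hf.1 20 rfl
    have hm : τ.mem A = σ.mem A := by simpa using hf.2 A rfl
    have hp : 2 ^ (k + 1) ≤ 2 ^ σ.reg 21 := Nat.pow_le_pow_right (by norm_num) hk
    have h1 : bitsNum (σ.mem A) (σ.reg 20) (k + 1) < 2 ^ (k + 1) := bitsNum_lt fun j _ => hA _
    have h2 : 2 ^ (k + 1) = 2 ^ k + 2 ^ k := by ring
    have h3 : 2 ^ (σ.reg 21 + 1) = 2 ^ σ.reg 21 + 2 ^ σ.reg 21 := by ring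
    refine Runs.assign_seq (v := bitsNum (σ.mem A) (σ.reg 20) (k + 1)) ?_ (by omega)
      (Runs.assign (v := 2 ^ (k + 1)) ?_ (by omega) ?_)
    · simp [h20, h22, h23, h24, hm, bitsNum_succ]
    · simp [h23, h2]
    · simp [h24]
  · intro τ h _
    exact h.2.1

/-- Writes `reg 21` bits of the number `reg 22` into array `A`, from position `reg 20` on. -/
def unpackProg (A : ℕ) : Prog :=
  .forLt 24 (.reg 21)
    (.seq (.store A (.reg 20 + .reg 24) (.reg 22 % .const 2))
      (.assign 22 (.reg 22 / .const 2)))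

theorem runs_unpackProg {B A : ℕ} {σ : State} (hlen : σ.reg 21 < 2 ^ B) :
    Runs B (unpackProg A) σ (4 * σ.reg 21 + 2)
      (fun τ => ∀ j, τ.mem A j = if σ.reg 20 ≤ j ∧ j < σ.reg 20 + σ.reg 21 then
        σ.reg 22 / 2 ^ (j - σ.reg 20) % 2 else σ.mem A j) := by
  refine Runs.of_bounded fun hB hσ => ?_
  have hB0 : 1 < 2 ^ B := Nat.one_lt_two_pow (by omega)
  refine Runs.mono (Runs.forLt (l := 2)
      (fun k τ => τ.reg 22 = σ.reg 22 / 2 ^ k ∧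
        ∀ j, τ.mem A j = if σ.reg 20 ≤ j ∧ j < σ.reg 20 + k then
          σ.reg 22 / 2 ^ (j - σ.reg 20) % 2 else σ.mem A j)
      (σ.reg 21) hlen ?_ ?_ ?_) (by omega) (fun τ h _ => h.2.2)
  · refine ⟨by simp, fun j => ?_⟩
    rw [if_neg (by omega)]
    rfl
  · intro k τ _ _ hf
    exact hf.1 21 rfl
  · rintro k hk τ ⟨h22, hm⟩ h24 hf
    have h20 : τ.reg 20 = σ.reg 20 := hf.1 20 rfl
    refine Runs.store_seq (j := σ.reg 20 + k) (v := σ.reg 22 / 2 ^ k % 2) (by simp [h20, h24])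
      (by simp [h22]) ((Nat.mod_lt _ two_pos).trans_le hB0)
      (Runs.assign (v := σ.reg 22 / 2 ^ (k + 1)) (by simp [h22, Nat.div_div_eq_div_mul, pow_succ])
        ((Nat.div_le_self _ _).trans_lt (hσ.1 22)) ⟨by simp [h24], by simp, fun j => ?_⟩)
    simp only [State.setReg_mem, State.setMem_mem, if_true, Function.update_apply, hm]
    by_cases hj : j = σ.reg 20 + k
    · subst hj
      simp
    · rw [if_neg hj]
      congr 1
      simp only [eq_iff_iff]
      omega

/-- Computes in `reg 12` the first `reg 11` bits of the hash value of the block at `reg 10` of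
array `0`, with the seed in array `1` and the block length in `reg 5`. -/
def hashProg : Prog :=
  .seq (.assign 12 (.const 0)) (.seq (.assign 13 (.const 1))
    (.forLt 14 (.reg 11)
      (.seq (.assign 16 (.const 0))
        (.seq (.forLt 15 (.reg 5) (.assign 16
            (.reg 16 + .load 1 (.reg 14 + .reg 15) * .load 0 (.reg 10 + .reg 15))))
          (.seq (.assign 12 (.reg 12 + .reg 16 % .const 2 * .reg 13))
            (.assign 13 (.reg 13 + .reg 13)))))))

theorem runs_hashProg {B : ℕ} {σ : State} (h0 : ∀ j, σ.mem 0 j ≤ 1) (h1 : ∀ j, σ.mem 1 j ≤ 1)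
    (hκ : σ.reg 11 < B) (hb : σ.reg 5 < 2 ^ B) :
    Runs B hashProg σ (σ.reg 11 * (3 * σ.reg 5 + 7) + 4)
      (fun τ => τ.reg 12 = hashNum (σ.reg 5) (σ.mem 0) (σ.mem 1) (σ.reg 10) (σ.reg 11)) := by
  have hB : σ.reg 11 < 2 ^ B := hκ.trans Nat.lt_two_pow_self
  have hB1 : 2 ^ (σ.reg 11 + 1) ≤ 2 ^ B := Nat.pow_le_pow_right (by norm_num) hκ
  have hB0 : 1 < 2 ^ B := Nat.one_lt_two_pow (by omega)
  refine Runs.le (Runs.assign_seq (v := 0) rfl (by omega) (Runs.assign_seq (v := 1) rfl (by omega)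
    (Runs.mono (l := _) (Runs.forLt (l := 3 * σ.reg 5 + 5)
      (fun k τ => τ.reg 12 = hashNum (σ.reg 5) (σ.mem 0) (σ.mem 1) (σ.reg 10) k ∧
        τ.reg 13 = 2 ^ k)
      (σ.reg 11) hB ?_ ?_ ?_) le_rfl ?_))) (by ring_nf; omega)
  · simp [hashNum, bitsNum]
  · intro k τ _ _ hf
    simpa using hf.1 11 rfl
  · rintro k hk τ ⟨h12, h13⟩ h14 hf
    have h10 : τ.reg 10 = σ.reg 10 := by simpa using hf.1 10 rfl
    have h5 : τ.reg 5 = σ.reg 5 := by simpa using hf.1 5 rfl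
    have hm0 : τ.mem 0 = σ.mem 0 := by simpa using hf.2 0 rfl
    have hm1 : τ.mem 1 = σ.mem 1 := by simpa using hf.2 1 rfl
    have hp : 2 ^ (k + 1) ≤ 2 ^ σ.reg 11 := Nat.pow_le_pow_right (by norm_num) hk
    have h3 : hashNum (σ.reg 5) (σ.mem 0) (σ.mem 1) (σ.reg 10) (k + 1) < 2 ^ (k + 1) :=
      hashNum_lt ..
    have h4 : 2 ^ (k + 1) = 2 ^ k + 2 ^ k := by ring
    have h6 : 2 ^ (σ.reg 11 + 1) = 2 ^ σ.reg 11 + 2 ^ σ.reg 11 := by ring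
    refine Runs.le (k := 1 + (σ.reg 5 * (1 + 2) + 2 + (1 + 1)))
      (Runs.assign_seq (v := 0) rfl (by omega) (Runs.seq (Runs.forLt (l := 1)
      (fun j υ => υ.reg 16 = ∑ j ∈ Finset.range j,
        σ.mem 1 (k + j) * σ.mem 0 (σ.reg 10 + j)) (σ.reg 5) hb ?_ ?_ ?_) ?_)) (by omega)
    · simp
    · intro j υ _ _ hg
      simpa [h5] using hg.1 5 rfl
    · intro j hj υ h16 h15 hg
      have g14 : υ.reg 14 = k := by simpa [h14] using hg.1 14 rfl
      have g10 : υ.reg 10 = σ.reg 10 := by simpa [h10] using hg.1 10 rfl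
      have gm0 : υ.mem 0 = σ.mem 0 := by simpa [hm0] using hg.2 0 rfl
      have gm1 : υ.mem 1 = σ.mem 1 := by simpa [hm1] using hg.2 1 rfl
      have hle : ∑ j ∈ Finset.range (j + 1), σ.mem 1 (k + j) * σ.mem 0 (σ.reg 10 + j) ≤ j + 1 := by
        refine (Finset.sum_le_card_nsmul _ _ 1 fun i _ => ?_).trans (by simp)
        exact Nat.mul_le_mul (h1 _) (h0 _)
      refine Runs.assign (v := ∑ j ∈ Finset.range (j + 1),
        σ.mem 1 (k + j) * σ.mem 0 (σ.reg 10 + j)) ?_ (by omega) ?_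
      · simp [h16, h15, g14, g10, gm0, gm1, Finset.sum_range_succ]
      · simp [h15]
    · rintro υ ⟨_, h16⟩ hg
      have g12 := hg.1 12 rfl
      have g13 := hg.1 13 rfl
      have g14 := hg.1 14 rfl
      simp only [State.setReg_reg, h12, h13, h14, Nat.reduceEqDiff,
        if_false] at g12 g13 g14
      refine Runs.assign_seq (v := hashNum (σ.reg 5) (σ.mem 0) (σ.mem 1) (σ.reg 10) (k + 1)) ?_
        (by omega) (Runs.assign (v := 2 ^ (k + 1)) ?_ (by omega) ?_)
      · simp [g12, g13, h16, hashNum, bitsNum_succ, hashBit]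
      · simp [g13, h4]
      · simp [g14]
  · intro τ h _
    exact h.2.1

end RAM

/-! ### Good seeds for Hankel hashing -/

/-- The Hankel matrix of `a` with `κ` rows, restricted to the columns in `S`. -/
def hankel (a : ℕ → ZMod 2) (S : Finset ℕ) (κ : ℕ) : Matrix (Fin κ) S (ZMod 2) :=
  Matrix.of fun i j => a (i + j)

/-- A proper subspace lies in the kernel of a nonzero functional; `y` is its coordinate vector. -/
theorem exists_zero_combination_of_not_surjective {a : ℕ → ZMod 2} {S : Finset ℕ} {κ : ℕ}
    (h : ¬ Function.Surjective (hankel a S κ).mulVec) :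
    ∃ y : Fin κ → ZMod 2, y ≠ 0 ∧ ∀ j ∈ S, ∑ i, y i * a (i + j) = 0 := by
  have hlt : LinearMap.range (hankel a S κ).mulVecLin < ⊤ := by
    rw [lt_top_iff_ne_top]
    intro ht
    exact h (LinearMap.range_eq_top.1 ht)
  obtain ⟨f, hf, hr⟩ := Submodule.exists_le_ker_of_lt_top _ hlt
  have hsum : ∀ x, f x = ∑ i, x i * f (fun j => if i = j then 1 else 0) := fun x => by
    simpa using LinearMap.pi_apply_eq_sum_univ f x
  refine ⟨fun i => f (fun j => if i = j then 1 else 0), fun h0 => hf ?_, fun j hj => ?_⟩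
  · refine LinearMap.ext fun x => ?_
    rw [hsum]
    refine Finset.sum_eq_zero fun i _ => ?_
    rw [show f (fun j => if i = j then 1 else 0) = 0 from congrFun h0 i, mul_zero]
  · have : f ((hankel a S κ).mulVec (Pi.single ⟨j, hj⟩ 1)) = 0 := hr ⟨_, rfl⟩
    rw [hsum] at this
    simpa [hankel, mul_comm] using this

/-- The system is triangular: equation `j` is the first in which `a (d + j)` occurs, and there its
coefficient is one, so the values are chosen in turn. -/
theorem exists_solution_of_leading_coeff (y c : ℕ → ZMod 2) (d n : ℕ) :
    ∃ a : ℕ → ZMod 2, ∀ j < n, ∑ i ∈ Finset.range d, y i * a (i + j) + a (d + j) = c j := by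
  induction n with
  | zero => exact ⟨0, by simp⟩
  | succ n ih =>
    obtain ⟨a, ha⟩ := ih
    refine ⟨Function.update a (d + n) (c n - ∑ i ∈ Finset.range d, y i * a (i + n)),
      fun j hj => ?_⟩
    have hs : ∑ i ∈ Finset.range d, y i * Function.update a (d + n)
        (c n - ∑ i ∈ Finset.range d, y i * a (i + n)) (i + j) =
        ∑ i ∈ Finset.range d, y i * a (i + j) := by
      refine Finset.sum_congr rfl fun i hi => ?_
      have := Finset.mem_range.1 hi
      rw [Function.update_of_ne (by omega)]
    rw [hs]
    rcases Nat.lt_succ_iff_lt_or_eq.1 hj with hj | rfl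
    · rw [Function.update_of_ne (by omega), ha j hj]
    · simp

/-- The combination of the rows of Hankel matrices with coefficients `y`, as a function of the
seed. -/
def hankelCombination {b κ : ℕ} (hκ : κ ≤ b) (S : Finset (Fin b)) (y : Fin κ → ZMod 2) :
    (Fin (2 * b) → ZMod 2) →ₗ[ZMod 2] (S → ZMod 2) where
  toFun a j := ∑ i, y i * a ⟨i + j.1, by omega⟩
  map_add' a a' := by ext j; simp [mul_add, Finset.sum_add_distrib]
  map_smul' r a := by
    ext j
    simp only [Pi.smul_apply, smul_eq_mul, RingHom.id_apply, Finset.mul_sum]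
    exact Finset.sum_congr rfl fun i _ => by ring

theorem hankelCombination_surjective {b κ : ℕ} (hκ : κ ≤ b) (S : Finset (Fin b))
    {y : Fin κ → ZMod 2} (hy : y ≠ 0) : Function.Surjective (hankelCombination hκ S y) := by
  intro c
  -- The largest index with a nonzero coefficient is the pivot of the triangular system.
  obtain ⟨d, hd, hmax⟩ : ∃ d : Fin κ, y d ≠ 0 ∧ ∀ i, d < i → y i = 0 := by
    obtain ⟨i, hi⟩ := Function.ne_iff.1 hy
    have hne : (Finset.univ.filter fun i => y i ≠ 0).Nonempty := ⟨i, by simpa using hi⟩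
    refine ⟨_, (Finset.mem_filter.1 (Finset.max'_mem _ hne)).2, fun i hi => ?_⟩
    by_contra h0
    exact absurd (Finset.le_max' _ i (by simpa using h0)) (not_le.2 hi)
  have hd1 : y d = 1 := by
    have : ∀ z : ZMod 2, z ≠ 0 → z = 1 := by decide
    exact this _ hd
  -- The target is prescribed on all `b` columns, with the value zero outside `S`.
  obtain ⟨a, ha⟩ := exists_solution_of_leading_coeff
    (fun i => if h : i < κ then y ⟨i, h⟩ else 0)
    (fun j => if h : ∃ h : j < b, (⟨j, h⟩ : Fin b) ∈ S then c ⟨⟨j, h.1⟩, h.2⟩ else 0) d b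
  refine ⟨fun i => a i, ?_⟩
  ext j
  have hj := ha j.1 j.1.2
  rw [dif_pos ⟨j.1.2, j.2⟩] at hj
  rw [← hj]
  change ∑ i : Fin κ, y i * a (i + j.1) = _
  have hext : ∑ i : Fin κ, y i * a (i + j.1) = ∑ i ∈ Finset.range κ,
      (if h : i < κ then y ⟨i, h⟩ else 0) * a (i + j.1) := by
    rw [Finset.sum_range]
    simp
  have hsub : ∑ i ∈ Finset.range κ, (if h : i < κ then y ⟨i, h⟩ else 0) * a (i + j.1) =
      ∑ i ∈ Finset.range (d + 1), (if h : i < κ then y ⟨i, h⟩ else 0) * a (i + j.1) := by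
    symm
    refine Finset.sum_subset (Finset.range_mono (by omega)) fun i hi hi' => ?_
    have h1 := Finset.mem_range.1 hi
    have h2 : d.1 < i := by
      have := mt Finset.mem_range.2 hi'
      omega
    rw [dif_pos h1, hmax _ (Fin.lt_def.2 h2), zero_mul]
  rw [hext, hsub, Finset.sum_range_succ]
  simp [hd1]

/-- Rank and nullity: surjectivity means that the `S.card` conditions on the seed are independent.
-/
theorem card_ker_hankelCombination {b κ : ℕ} (hκ : κ ≤ b) (S : Finset (Fin b))
    {y : Fin κ → ZMod 2} (hy : y ≠ 0) :
    Nat.card (LinearMap.ker (hankelCombination hκ S y)) = 2 ^ (2 * b - S.card) := by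
  have h1 := LinearMap.finrank_range_add_finrank_ker (hankelCombination hκ S y)
  rw [LinearMap.range_eq_top.2 (hankelCombination_surjective hκ S hy), finrank_top] at h1
  simp only [Module.finrank_fintype_fun_eq_card, Fintype.card_coe, Fintype.card_fin] at h1
  rw [Module.natCard_eq_pow_finrank (K := ZMod 2), Nat.card_zmod]
  congr 1
  omega

open Finset in
/-- If `n < 2 ^ t`, some seed makes the Hankel matrices of `n` sets of columns surjective, where
each matrix has `t` rows fewer than columns. -/
theorem exists_surjective_hankel {b t n : ℕ} (hn : n < 2 ^ t) (S : ℕ → Finset ℕ)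
    (hS : ∀ p, S p ⊆ Finset.range b) :
    ∃ a : ℕ → ZMod 2, ∀ p < n, t ≤ (S p).card →
      Function.Surjective (hankel a (S p) ((S p).card - t)).mulVec := by
  classical
  by_contra! hbad
  have hcard : ∀ p, (S p).card ≤ b := fun p => by simpa using Finset.card_le_card (hS p)
  let κ : ℕ → ℕ := fun p => (S p).card - t
  have hκ : ∀ p, κ p ≤ b := fun p => (Nat.sub_le _ _).trans (hcard p)
  let S' : ℕ → Finset (Fin b) := fun p => (S p).attachFin fun i hi => by
    simpa using hS p hi
  have hS' : ∀ p, (S' p).card = (S p).card := fun p => Finset.card_attachFin _ _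
  let Z : ∀ p, (Fin (κ p) → ZMod 2) → Finset (Fin (2 * b) → ZMod 2) := fun p y =>
    univ.filter fun a => a ∈ LinearMap.ker (hankelCombination (hκ p) (S' p) y)
  have hZ : ∀ p, ∀ y ≠ 0, (Z p y).card = 2 ^ (2 * b - (S p).card) := fun p y hy => by
    rw [← hS', ← card_ker_hankelCombination (hκ p) (S' p) hy]
    exact (Nat.subtype_card _ fun a => by simp [Z]).symm
  -- If every seed were bad, the kernels that belong to the pairs (block, nonzero combination of
  -- rows) would cover the whole seed space.
  have hcover : (univ : Finset (Fin (2 * b) → ZMod 2)) ⊆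
      ((range n).filter fun p => t ≤ (S p).card).biUnion fun p =>
        (univ.filter fun y : Fin (κ p) → ZMod 2 => y ≠ 0).biUnion (Z p) := by
    intro a _
    obtain ⟨p, hp, ht, hsurj⟩ := hbad fun i => if h : i < 2 * b then a ⟨i, h⟩ else 0
    obtain ⟨y, hy, hsum⟩ := exists_zero_combination_of_not_surjective hsurj
    refine mem_biUnion.2 ⟨p, by simp [hp, ht], mem_biUnion.2 ⟨y, by simpa using hy, ?_⟩⟩
    simp only [Z, mem_filter, mem_univ, true_and, LinearMap.mem_ker]
    ext j
    have hj := hsum j.1 ((Finset.mem_attachFin _).1 j.2)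
    change ∑ i : Fin (κ p), y i * a ⟨i + j.1, _⟩ = 0
    rw [← hj]
    refine Finset.sum_congr rfl fun i _ => ?_
    have := hκ p
    have : i.1 < κ p := i.2
    rw [dif_pos (by omega)]
  have h1 := (card_le_card hcover).trans card_biUnion_le
  -- With `|S p| - t` rows there are at most `2 ^ (|S p| - t)` combinations, each killed by `2 ^ (2
  -- * b - |S p|)` seeds. The product does not depend on the block.
  have h2 : ∀ p ∈ (range n).filter fun p => t ≤ (S p).card,
      ((univ.filter fun y : Fin (κ p) → ZMod 2 => y ≠ 0).biUnion (Z p)).card ≤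
        2 ^ (2 * b - t) := by
    intro p hp
    have hp' := (mem_filter.1 hp).2
    calc _ ≤ ∑ y ∈ univ.filter fun y : Fin (κ p) → ZMod 2 => y ≠ 0, (Z p y).card :=
          card_biUnion_le
      _ = ∑ y ∈ univ.filter fun y : Fin (κ p) → ZMod 2 => y ≠ 0, 2 ^ (2 * b - (S p).card) :=
          sum_congr rfl fun y hy => hZ p y (mem_filter.1 hy).2
      _ ≤ ∑ y : Fin (κ p) → ZMod 2, 2 ^ (2 * b - (S p).card) :=
          sum_le_sum_of_subset (filter_subset _ _)
      _ = 2 ^ (κ p) * 2 ^ (2 * b - (S p).card) := by simp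
      _ = 2 ^ (2 * b - t) := by
          rw [← pow_add]
          have := hcard p
          congr 1
          simp only [κ]
          omega
  have h3 := h1.trans (sum_le_card_nsmul _ _ _ h2)
  have h4 : ((range n).filter fun p => t ≤ (S p).card).card ≤ n :=
    (card_filter_le _ _).trans (by simp)
  have hpos : ((range n).filter fun p => t ≤ (S p).card).Nonempty := by
    obtain ⟨p, hp, ht, _⟩ := hbad 0
    exact ⟨p, by simp [hp, ht]⟩
  have htb : t ≤ 2 * b := by
    obtain ⟨p, hp⟩ := hpos
    have := (mem_filter.1 hp).2
    have := hcard p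
    omega
  simp only [card_univ, Fintype.card_fun, Fintype.card_fin, ZMod.card, smul_eq_mul] at h3
  have h5 : n * 2 ^ (2 * b - t) < 2 ^ t * 2 ^ (2 * b - t) :=
    Nat.mul_lt_mul_of_pos_right hn (by positivity)
  rw [← pow_add, Nat.add_sub_cancel' htb] at h5
  exact absurd (h3.trans (Nat.mul_le_mul_right _ h4)) (not_le.2 h5)

/-- A seed for which, in each of `n` blocks, every hash value of `t` bits fewer than there are
columns in `S p` is attained by changing the block in the columns of `S p` only. -/
theorem exists_seed {b t n : ℕ} (hn : n < 2 ^ t) (S : ℕ → Finset ℕ)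
    (hS : ∀ p, S p ⊆ Finset.range b) :
    ∃ a < 2 ^ (2 * b), ∀ p < n, t ≤ (S p).card → ∀ T < 2 ^ ((S p).card - t),
      ∀ (W A : ℕ → ℕ) (base : ℕ), (∀ j < 2 * b, A j = a / 2 ^ j % 2) →
      ∃ x < 2 ^ b, ∀ W' : ℕ → ℕ,
        (∀ j < b, W' (base + j) = if j ∈ S p then x / 2 ^ j % 2 else W (base + j)) →
        hashNum b W' A base ((S p).card - t) = T := by
  obtain ⟨a, ha⟩ := exists_surjective_hankel hn S hS
  have hval : ∀ z : ZMod 2, z.val ≤ 1 := fun z => Nat.lt_succ_iff.1 (ZMod.val_lt z)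
  obtain ⟨a', ha', hdig⟩ := exists_lt_two_pow_digits (fun j => (a j).val) (fun j => hval _) (2 * b)
  refine ⟨a', ha', fun p hp ht T hT W A base hA => ?_⟩
  have hcard : (S p).card ≤ b := by simpa using Finset.card_le_card (hS p)
  -- The free columns have to contribute the target minus the contribution of the frozen cells.
  obtain ⟨z, hz⟩ := ha p hp ht fun i => ((T / 2 ^ i.1 % 2 : ℕ) : ZMod 2) -
    ∑ j ∈ Finset.range b \ S p, a (i + j) * (W (base + j) : ZMod 2)
  obtain ⟨x, hx, hxd⟩ := exists_lt_two_pow_digits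
    (fun j => if h : j ∈ S p then (z ⟨j, h⟩).val else 0)
    (fun j => by split_ifs <;> simp [hval]) b
  refine ⟨x, hx, fun W' hW' => ?_⟩
  have hbit : ∀ i < (S p).card - t, hashBit b W' A base i = T / 2 ^ i % 2 := by
    intro i hi
    have hcast : ((∑ j ∈ Finset.range b, A (i + j) * W' (base + j) : ℕ) : ZMod 2) =
        ((T / 2 ^ i % 2 : ℕ) : ZMod 2) := by
      have hzi := congrFun hz ⟨i, hi⟩
      rw [eq_sub_iff_add_eq] at hzi
      rw [← hzi, ← Finset.sum_sdiff (hS p), add_comm]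
      push_cast
      have hAa : ∀ j < b, (A (i + j) : ZMod 2) = a (i + j) := fun j hj => by
        rw [hA _ (by omega), hdig _ (by omega), ZMod.natCast_zmod_val]
      congr 1
      · simp only [Matrix.mulVec, dotProduct, hankel, Matrix.of_apply]
        rw [← Finset.sum_coe_sort (S p)]
        refine Finset.sum_congr rfl fun j _ => ?_
        have hjb : j.1 < b := Finset.mem_range.1 (hS p j.2)
        rw [hAa _ hjb, hW' _ hjb, if_pos j.2, hxd _ hjb, dif_pos j.2, ZMod.natCast_zmod_val]
      · refine Finset.sum_congr rfl fun j hj => ?_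
        obtain ⟨hj1, hj2⟩ := Finset.mem_sdiff.1 hj
        have hjb := Finset.mem_range.1 hj1
        rw [hAa _ hjb, hW' _ hjb, if_neg hj2]
    rw [ZMod.natCast_eq_natCast_iff'] at hcast
    rw [hashBit, hcast, Nat.mod_mod]
  rw [hashNum, bitsNum_congr (M' := fun j => T / 2 ^ j % 2) (off' := 0)
    (fun j hj => by simpa using hbit j hj), bitsNum_digits, Nat.mod_eq_of_lt hT]

/-! ### The linked list of blocks -/

/-- One step of the decoder. In `(y, out)`, the number `y` holds the position in the message, the
block and the number of hash bits to be read; the first `2 * t` bits read are the next `y`. -/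
def decodeStep (N b t : ℕ) (W A : ℕ → ℕ) (s : ℕ × (ℕ → ℕ)) : ℕ × (ℕ → ℕ) :=
  (hashNum b W A (s.1 % N / b * b) (s.1 % N % b) % 2 ^ (2 * t),
    fun j => if s.1 / N ≤ j ∧ j < s.1 / N + (s.1 % N % b - 2 * t) then
      hashNum b W A (s.1 % N / b * b) (s.1 % N % b) / 2 ^ (2 * t) / 2 ^ (j - s.1 / N) % 2
    else s.2 j)

/-- The message bits (followed by padding) that the decoder finds. -/
def decodeBits (N b t n : ℕ) (W A : ℕ → ℕ) : ℕ → ℕ :=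
  ((decodeStep N b t W A)^[n] (bitsNum A (2 * b) (2 * t), 0)).2

/-- The state of the encoder after the first `p` blocks: the description of the last block in use,
and the number of message bits that are stored. `f p` is the number of free coordinates in block
`p`. -/
def blockChain (N b t : ℕ) (f : ℕ → ℕ) : ℕ → ℕ × ℕ
  | 0 => (0, 0)
  | p + 1 =>
    if 3 * t < f p then
      ((blockChain N b t f p).2 * N + (p * b + (f p - t)),
        (blockChain N b t f p).2 + (f p - t - 2 * t))
    else blockChain N b t f p

/-- The hash value that block `p` has to have. -/
def blockTarget (N b t : ℕ) (f m : ℕ → ℕ) (p : ℕ) : ℕ :=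
  (blockChain N b t f p).1 +
    2 ^ (2 * t) * bitsNum m (blockChain N b t f p).2 (f p - t - 2 * t)

section
variable {N b t n : ℕ} {f m : ℕ → ℕ}

theorem blockChain_snd_le (hf : ∀ p, f p ≤ b) (p : ℕ) :
    (blockChain N b t f p).2 ≤ p * b := by
  induction p with
  | zero => simp [blockChain]
  | succ p ih =>
    have := hf p
    rw [blockChain, add_one_mul]
    split_ifs
    · simp only; omega
    · omega

/-- A block in use gives up exactly `3 * t` of its free cells (`t` for surjectivity, `2 * t` for the
link); a block that is not in use has at most `3 * t` of them. -/
theorem le_blockChain_snd (p : ℕ) :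
    ∑ i ∈ Finset.range p, f i ≤ (blockChain N b t f p).2 + p * (3 * t) := by
  induction p with
  | zero => simp
  | succ p ih =>
    rw [Finset.sum_range_succ, blockChain, add_one_mul]
    split_ifs
    · simp only; omega
    · omega

/-- The description is a number in mixed radix. Since `t ≥ 1`, the hash length `f p - t` is below
`b` and hence a digit in base `b`; since the block lies inside `[0, N)`, the lower two digits
together stay below `N`. -/
theorem blockChain_succ_fst (ht : 1 ≤ t) (hf : ∀ p, f p ≤ b) (hn : n * b ≤ N) {p : ℕ} (hp : p < n)
    (h : 3 * t < f p) :
    (blockChain N b t f (p + 1)).1 / N = (blockChain N b t f p).2 ∧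
      (blockChain N b t f (p + 1)).1 % N / b = p ∧
      (blockChain N b t f (p + 1)).1 % N % b = f p - t ∧
      (blockChain N b t f p).2 < N ∧ p * b + (f p - t) < N := by
  have h1 := hf p
  have h2 : (p + 1) * b ≤ N := (Nat.mul_le_mul_right _ hp).trans hn
  rw [add_one_mul] at h2
  have h3 : p * b + (f p - t) < N := by omega
  have h4 : (blockChain N b t f p).2 < N := by
    have := blockChain_snd_le (N := N) (t := t) hf p
    omega
  have h5 : f p - t < b := by omega
  rw [blockChain, if_pos h]
  refine ⟨?_, ?_, ?_, h4, h3⟩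
  · rw [add_comm, Nat.add_mul_div_right _ _ (by omega), Nat.div_eq_of_lt h3, zero_add]
  · rw [Nat.mul_add_mod', Nat.mod_eq_of_lt h3, add_comm, Nat.add_mul_div_right _ _ (by omega),
      Nat.div_eq_of_lt h5, zero_add]
  · rw [Nat.mul_add_mod', Nat.mod_eq_of_lt h3, Nat.mul_add_mod', Nat.mod_eq_of_lt h5]

/-- A description is below `N * N`, because the position in the message is below `N` too. -/
theorem blockChain_fst_lt (ht : 1 ≤ t) (hf : ∀ p, f p ≤ b) (hn : n * b ≤ N) (hN : N < 2 ^ t)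
    {p : ℕ} (hp : p ≤ n) : (blockChain N b t f p).1 < 2 ^ (2 * t) := by
  induction p with
  | zero => simp [blockChain]
  | succ p ih =>
    by_cases h : 3 * t < f p
    · obtain ⟨-, -, -, h4, h5⟩ := blockChain_succ_fst ht hf hn hp h
      rw [blockChain, if_pos h, two_mul, pow_add]
      have h6 : ((blockChain N b t f p).2 + 1) * N ≤ N * N := Nat.mul_le_mul_right _ h4
      have h7 : N * N < 2 ^ t * 2 ^ t := Nat.mul_lt_mul'' hN hN
      rw [add_one_mul] at h6
      simp only
      omega
    · rw [blockChain, if_neg h]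
      exact ih (by omega)

theorem blockTarget_lt (ht : 1 ≤ t) (hf : ∀ p, f p ≤ b) (hn : n * b ≤ N) (hN : N < 2 ^ t)
    (hm : ∀ j, m j ≤ 1) {p : ℕ} (hp : p < n) (h : 3 * t < f p) :
    blockTarget N b t f m p < 2 ^ (f p - t) := by
  have h1 := blockChain_fst_lt ht hf hn hN hp.le
  have h2 : bitsNum m (blockChain N b t f p).2 (f p - t - 2 * t) < 2 ^ (f p - t - 2 * t) :=
    bitsNum_lt fun _ _ => hm _
  have h3 : 2 ^ (f p - t) = 2 ^ (2 * t) * 2 ^ (f p - t - 2 * t) := by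
    rw [← pow_add]
    congr 1
    omega
  rw [blockTarget, h3]
  nlinarith

/-- The list ends in the number `0`, which announces zero hash bits and thus reproduces itself. The
decoder may always make `n` steps without knowing the length of the list. -/
theorem decodeStep_zero (W A out : ℕ → ℕ) :
    decodeStep N b t W A (0, out) = (0, out) := by
  simp [decodeStep, hashNum, bitsNum]

/-- Induction on `p`, for all numbers of steps that are at least `p`: a block in use consumes one
step and delivers its segment of the message and the description of its predecessor; an unused block
consumes nothing, and surplus steps idle at `0`. -/
theorem decodeStep_iterate {W A : ℕ → ℕ} (ht : 1 ≤ t) (hf : ∀ p, f p ≤ b) (hn : n * b ≤ N)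
    (hN : N < 2 ^ t) (hm : ∀ j, m j ≤ 1)
    (hT : ∀ p < n, 3 * t < f p →
      hashNum b W A (p * b) (f p - t) = blockTarget N b t f m p) {p : ℕ} (hp : p ≤ n) :
    ∀ k, p ≤ k → ∀ out j, ((decodeStep N b t W A)^[k] ((blockChain N b t f p).1, out)).2 j =
      if j < (blockChain N b t f p).2 then m j else out j := by
  induction p with
  | zero =>
    intro k _ out j
    have : (decodeStep N b t W A)^[k] (0, out) = (0, out) :=
      Function.iterate_fixed (decodeStep_zero W A out) k
    simp [blockChain, this]
  | succ p ih =>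
    intro k hk out j
    have ih := ih (by omega)
    by_cases h : 3 * t < f p
    · obtain ⟨k, rfl⟩ : ∃ l, k = l + 1 := ⟨k - 1, by omega⟩
      obtain ⟨h1, h2, h3, -, -⟩ := blockChain_succ_fst ht hf hn (by omega) h
      have h4 := blockChain_fst_lt ht hf hn hN (by omega : p ≤ n)
      have h5 : blockTarget N b t f m p % 2 ^ (2 * t) = (blockChain N b t f p).1 := by
        rw [blockTarget, Nat.add_mul_mod_self_left, Nat.mod_eq_of_lt h4]
      have h6 : blockTarget N b t f m p / 2 ^ (2 * t) =
          bitsNum m (blockChain N b t f p).2 (f p - t - 2 * t) := by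
        rw [blockTarget, Nat.add_mul_div_left _ _ (by positivity), Nat.div_eq_of_lt h4, zero_add]
      rw [Function.iterate_succ_apply, decodeStep]
      simp only [h1, h2, h3, hT p (by omega) h, h5, h6]
      rw [ih k (by omega)]
      have h7 : (blockChain N b t f (p + 1)).2 =
          (blockChain N b t f p).2 + (f p - t - 2 * t) := by rw [blockChain, if_pos h]
      rw [h7]
      by_cases hj : j < (blockChain N b t f p).2
      · rw [if_pos hj, if_pos (by omega)]
      · rw [if_neg hj]
        by_cases hj' : j < (blockChain N b t f p).2 + (f p - t - 2 * t)
        · rw [if_pos ⟨by omega, hj'⟩, if_pos hj', bitsNum_div_mod (fun _ _ => hm _) (by omega)]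
          congr 1
          omega
        · rw [if_neg (by omega), if_neg hj']
    · have : blockChain N b t f (p + 1) = blockChain N b t f p := by rw [blockChain, if_neg h]
      rw [this]
      exact ih k (by omega) out j

theorem decodeBits_eq {W A : ℕ → ℕ} (ht : 1 ≤ t) (hf : ∀ p, f p ≤ b) (hn : n * b ≤ N)
    (hN : N < 2 ^ t) (hm : ∀ j, m j ≤ 1)
    (hT : ∀ p < n, 3 * t < f p →
      hashNum b W A (p * b) (f p - t) = blockTarget N b t f m p)
    (hy : bitsNum A (2 * b) (2 * t) = (blockChain N b t f n).1) {j : ℕ}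
    (hj : j < (blockChain N b t f n).2) : decodeBits N b t n W A j = m j := by
  rw [decodeBits, hy, decodeStep_iterate ht hf hn hN hm hT le_rfl n le_rfl, if_pos hj]

theorem decodeBits_le (W A : ℕ → ℕ) (j : ℕ) : decodeBits N b t n W A j ≤ 1 := by
  have : ∀ k s, (∀ j, s.2 j ≤ 1) → ((decodeStep N b t W A)^[k] s).2 j ≤ 1 := by
    intro k
    induction k with
    | zero => exact fun s h => h j
    | succ k ih =>
      intro s h
      rw [Function.iterate_succ_apply]
      refine ih _ fun j => ?_
      simp only [decodeStep]
      split_ifs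
      · exact Nat.lt_succ_iff.1 (Nat.mod_lt _ two_pos)
      · exact h j
  exact this n _ fun _ => Nat.zero_le _

end

namespace RAM

/-! ### The decoder -/

/-- For `N` in `reg 0`, computes the number `t` of bits of `N` in `reg 3`, `2 ^ t` in `reg 4`, the
block length `b = 6 * q * t` in `reg 5`, the number of blocks in `reg 6` and `2 ^ (2 * t)` in
`reg 7`. -/
def setupProg (q : ℕ) : Prog :=
  .seq (.assign 3 (.const 0)) (.seq (.assign 4 (.const 1))
    (.seq (.loop (.op .lt (.reg 4) (.reg 0 + .const 1))
      (.seq (.assign 3 (.reg 3 + .const 1)) (.assign 4 (.reg 4 + .reg 4))))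
      (.seq (.assign 5 (.const (6 * q) * .reg 3))
        (.seq (.assign 6 (.reg 0 / .reg 5)) (.assign 7 (.reg 4 * .reg 4))))))

/-- The outcome of `setupProg`. -/
structure IsSetup (q N : ℕ) (σ : State) : Prop where
  reg0 : σ.reg 0 = N
  reg3 : σ.reg 3 = N.size
  reg4 : σ.reg 4 = 2 ^ N.size
  reg5 : σ.reg 5 = 6 * q * N.size
  reg6 : σ.reg 6 = N / (6 * q * N.size)
  reg7 : σ.reg 7 = 2 ^ (2 * N.size)

theorem IsSetup.congr {q N : ℕ} {σ τ : State} (h : IsSetup q N σ)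
    (h0 : τ.reg 0 = σ.reg 0) (h3 : τ.reg 3 = σ.reg 3) (h4 : τ.reg 4 = σ.reg 4)
    (h5 : τ.reg 5 = σ.reg 5) (h6 : τ.reg 6 = σ.reg 6) (h7 : τ.reg 7 = σ.reg 7) :
    IsSetup q N τ :=
  ⟨h0.trans h.reg0, h3.trans h.reg3, h4.trans h.reg4, h5.trans h.reg5, h6.trans h.reg6,
    h7.trans h.reg7⟩

/-- Doubling until the power of two exceeds `N` takes exactly `N.size` rounds. -/
theorem runs_setupProg {B q N : ℕ} {σ : State} (hN : σ.reg 0 = N) (hB : 2 * N.size < B)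
    (hB' : 6 * q * N.size < B) :
    Runs B (setupProg q) σ (3 * N.size + 6) (IsSetup q N) := by
  refine Runs.of_bounded fun hB1 hσ => ?_
  have hNB : N < 2 ^ B := hN ▸ hσ.1 0
  have hB0 : 1 < 2 ^ B := Nat.one_lt_two_pow (by omega)
  have hBB : B < 2 ^ B := Nat.lt_two_pow_self
  have hpow : ∀ k ≤ N.size, 2 ^ k < 2 ^ B := fun k hk =>
    Nat.pow_lt_pow_right (by norm_num) (by omega)
  refine Runs.le (Runs.assign_seq (v := 0) rfl (by omega) (Runs.assign_seq (v := 1) rfl hB0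
    (Runs.seq (Runs.loop (l := 2)
      (fun k τ => τ.reg 3 = k ∧ τ.reg 4 = 2 ^ k ∧ k ≤ N.size) N.size ?_ ?_)
      (l := 3) ?_))) (by omega)
  · simp
  · rintro k τ ⟨h3, h4, hk⟩ hf hz
    have h0 : τ.reg 0 = N := by simpa [hN] using hf.1 0 rfl
    have hk' : k < N.size := by
      rw [Nat.lt_size]
      by_contra hc
      rw [Expr.eval_lt, if_neg (by simp [h4, h0]; omega)] at hz
      exact hz rfl
    refine ⟨hk', Runs.assign_seq (v := k + 1) (by simp [h3]) (by omega)
      (Runs.assign (v := 2 ^ (k + 1)) (by simp [h4, pow_succ, mul_two]) (hpow _ hk')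
        ⟨by simp, by simp, hk'⟩)⟩
  · rintro τ ⟨hz, k, -, h3, h4, hk⟩ hf
    have h0 : τ.reg 0 = N := by simpa [hN] using hf.1 0 rfl
    have hk' : k = N.size := by
      refine le_antisymm hk (Nat.size_le.2 ?_)
      by_contra hc
      rw [Expr.eval_lt, if_pos (by simp [h4, h0]; omega)] at hz
      exact one_ne_zero hz
    subst hk'
    refine Runs.assign_seq (v := 6 * q * N.size) (by simp [h3]) (by omega)
      (Runs.assign_seq (v := N / (6 * q * N.size)) (by simp [h0])
        ((Nat.div_le_self _ _).trans_lt hNB)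
        (Runs.assign (v := 2 ^ (2 * N.size)) (by simp [h4, two_mul, pow_add])
          (Nat.pow_lt_pow_right (by norm_num) hB) ?_))
    constructor <;> simp [h0, h3, h4]

/-- One step of the decoder. -/
def decodeStepProg : Prog :=
  .seq (.assign 33 (.reg 30 / .reg 0))
    (.seq (.assign 11 (.reg 30 % .reg 0 % .reg 5))
      (.seq (.assign 10 (.reg 30 % .reg 0 / .reg 5 * .reg 5))
        (.seq hashProg
          (.seq (.assign 30 (.reg 12 % .reg 7))
            (.seq (.assign 20 (.reg 33))
              (.seq (.assign 21 (.reg 11 - (.reg 3 + .reg 3)))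
                (.seq (.assign 22 (.reg 12 / .reg 7)) (unpackProg 5))))))))

theorem runs_decodeStepProg {B q N t b : ℕ} {σ : State} (hs : IsSetup q N σ)
    (htN : t = N.size) (hbt : b = 6 * q * t) (hb1 : 1 ≤ b) (hb : b < B) (hb' : 2 * t < B)
    (h0 : ∀ j, σ.mem 0 j ≤ 1) (h1 : ∀ j, σ.mem 1 j ≤ 1) :
    Runs B decodeStepProg σ (3 * b * b + 11 * b + 13)
      (fun τ => (τ.reg 30, τ.mem 5) =
        decodeStep N b t (σ.mem 0) (σ.mem 1) (σ.reg 30, σ.mem 5)) := by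
  refine Runs.of_bounded fun hB1 hσ => ?_
  subst htN
  have e0 := hs.reg0
  have e3 := hs.reg3
  have e5 := hs.reg5
  have e7 := hs.reg7
  rw [← hbt] at e5
  have hy : σ.reg 30 < 2 ^ B := hσ.1 30
  set y := σ.reg 30 with hyd
  have hz : y % N ≤ y := Nat.mod_le _ _
  -- The reduction modulo `b` bounds the hash length for every `y`. Hence the time bound also holds
  -- on inputs that no encoder produces.
  have hκ : y % N % b < b := Nat.mod_lt _ hb1
  have hbase : y % N / b * b ≤ y % N := Nat.div_mul_le_self _ _
  have hbB : b < 2 ^ B := hb.trans Nat.lt_two_pow_self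
  set hd := hashNum b (σ.mem 0) (σ.mem 1) (y % N / b * b) (y % N % b) with hhd
  have hhdB : hd < 2 ^ B := (hashNum_lt ..).trans
    (Nat.pow_lt_pow_right (by norm_num) (by omega))
  refine Runs.le (Runs.assign_seq (v := y / N) (by simp [e0, hyd])
    ((Nat.div_le_self _ _).trans_lt hy)
    (Runs.assign_seq (v := y % N % b) (by simp [e0, e5, hyd]) (by omega)
      (Runs.assign_seq (v := y % N / b * b) (by simp [e0, e5, hyd]) (by omega)
        (Runs.seq (runs_hashProg ?_ ?_ ?_ ?_) (l := 4 * b + 6) ?_)))) ?_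
  · simpa using h0
  · simpa using h1
  · simp; omega
  · simpa [e5] using hbB
  · intro τ h12 hf
    have f3 : τ.reg 3 = N.size := by simpa [e3] using hf.1 3 rfl
    have f7 : τ.reg 7 = 2 ^ (2 * N.size) := by simpa [e7] using hf.1 7 rfl
    have f11 : τ.reg 11 = y % N % b := by simpa using hf.1 11 rfl
    have f33 : τ.reg 33 = y / N := by simpa using hf.1 33 rfl
    have fm5 : τ.mem 5 = σ.mem 5 := by simpa using hf.2 5 rfl
    simp [e5, ← hhd] at h12
    refine Runs.le (Runs.assign_seq (v := hd % 2 ^ (2 * N.size)) (by simp [h12, f7])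
      ((Nat.mod_le _ _).trans_lt hhdB)
      (Runs.assign_seq (v := y / N) (by simp [f33]) ((Nat.div_le_self _ _).trans_lt hy)
        (Runs.assign_seq (v := y % N % b - 2 * N.size) (by simp [f11, f3]; omega) (by omega)
          (Runs.assign_seq (v := hd / 2 ^ (2 * N.size)) (by simp [h12, f7])
            ((Nat.div_le_self _ _).trans_lt hhdB)
            (Runs.mono (runs_unpackProg (by simp; omega)) le_rfl ?_))))) ?_
    · intro υ hυ hg
      have g30 := hg.1 30 rfl
      refine Prod.ext ?_ (funext fun j => ?_)
      · simpa [decodeStep, ← hhd] using g30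
      · simp only [hυ]
        simp [decodeStep, ← hhd, fm5]
    · simp; omega
  · simp [e5]
    nlinarith

/-- The decoder. -/
def decoderProg (q : ℕ) : Prog :=
  .seq (setupProg q)
    (.seq (.assign 20 (.reg 5 + .reg 5))
      (.seq (.assign 21 (.reg 3 + .reg 3))
        (.seq (packProg 1)
          (.seq (.assign 30 (.reg 22))
            (.seq (.assign 20 (.reg 5 + .reg 5 + (.reg 3 + .reg 3)))
              (.seq (.assign 21 (.reg 3))
                (.seq (packProg 1)
                  (.seq (.assign 31 (.reg 0 - (.const 1 + .reg 5 +
                      .reg 6 * (.const 3 * .reg 3)) - .reg 22))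
                    (.seq (.forLt 32 (.reg 6) decodeStepProg)
                      (.seq (.forLt 32 (.reg 31) (.store 0 (.reg 32) (.load 5 (.reg 32))))
                        (.assign 0 (.reg 31))))))))))))

theorem runs_decoderProg {B q N t b n : ℕ} {σ : State} (hN : σ.reg 0 = N)
    (htN : t = N.size) (hbt : b = 6 * q * t) (hnb : n = N / b) (hb1 : 1 ≤ b) (hb : 4 * b ≤ B)
    (hb' : 2 * t ≤ b) (h0 : ∀ j, σ.mem 0 j ≤ 1) (h1 : ∀ j, σ.mem 1 j ≤ 1)
    (h5 : ∀ j, σ.mem 5 j = 0) :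
    Runs B (decoderProg q) σ (n * (3 * b * b + 11 * b + 15) + 3 * N + 20 * b + 50)
      (fun τ => τ.reg 0 = N - (1 + b + n * (3 * t)) - bitsNum (σ.mem 1) (2 * b + 2 * t) t ∧
        ∀ j < τ.reg 0, τ.mem 0 j = decodeBits N b t n (σ.mem 0) (σ.mem 1) j) := by
  refine Runs.of_bounded fun hB1 hσ => ?_
  have hNB : N < 2 ^ B := hN ▸ hσ.1 0
  have hBB : B < 2 ^ B := Nat.lt_two_pow_self
  have hnN : n ≤ N := hnb ▸ Nat.div_le_self _ _
  set M := N - (1 + b + n * (3 * t)) - bitsNum (σ.mem 1) (2 * b + 2 * t) t with hM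
  have hMN : M ≤ N := by omega
  refine Runs.le (k := 3 * t + 6 + (1 + (1 + (4 * (2 * t) + 4 + (1 + (1 + (1 + (4 * t + 4 + (1 +
    (n * (3 * b * b + 11 * b + 13 + 2) + 2 + (M * (1 + 2) + 2 + 1)))))))))))
    (Runs.seq (htN ▸ runs_setupProg hN (by omega) (by rw [← htN, ← hbt]; omega)) ?_) ?_
  swap
  · ring_nf; omega
  rintro τ hs hf
  have s0 := hs.reg0
  have s3 := hs.reg3
  have s5 := hs.reg5
  have s6 := hs.reg6
  rw [← htN] at s3 s5 s6
  rw [← hbt] at s5 s6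
  rw [← hnb] at s6
  have m0 : τ.mem 0 = σ.mem 0 := hf.2 0 rfl
  have m1 : τ.mem 1 = σ.mem 1 := hf.2 1 rfl
  have m5 : τ.mem 5 = σ.mem 5 := hf.2 5 rfl
  have hyb : bitsNum (σ.mem 1) (2 * b) (2 * t) < 2 ^ (2 * t) := bitsNum_lt fun _ _ => h1 _
  have hyB : 2 ^ (2 * t) ≤ 2 ^ B := Nat.pow_le_pow_right (by norm_num) (by omega)
  refine Runs.assign_seq (v := 2 * b) (by simp [s5, two_mul]) (by omega)
    (Runs.assign_seq (v := 2 * t) (by simp [s3, two_mul]) (by omega)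
      (Runs.seq (Runs.le (runs_packProg ?_ ?_) ?_) ?_))
  · simpa [m1] using h1
  · simp; omega
  · simp
  intro τ₁ r22 hf₁
  have a0 := hf₁.1 0 rfl
  have a3 := hf₁.1 3 rfl
  have a4 := hf₁.1 4 rfl
  have a5 := hf₁.1 5 rfl
  have a6 := hf₁.1 6 rfl
  have a7 := hf₁.1 7 rfl
  have am0 := hf₁.2 0 rfl
  have am1 := hf₁.2 1 rfl
  have am5 := hf₁.2 5 rfl
  simp at r22 a0 a3 a4 a5 a6 a7 am0 am1 am5
  refine Runs.assign_seq (v := bitsNum (σ.mem 1) (2 * b) (2 * t)) (by simp [r22, m1]) (by omega)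
    (Runs.assign_seq (v := 2 * b + 2 * t) (by simp [a5, a3, s5, s3, two_mul]) (by omega)
      (Runs.assign_seq (v := t) (by simp [a3, s3]) (by omega)
        (Runs.seq (Runs.le (runs_packProg ?_ ?_) ?_) ?_)))
  · simpa [am1, m1] using h1
  · simp; omega
  · simp
  intro τ₂ r22' hf₂
  have b0 := hf₂.1 0 rfl
  have b3 := hf₂.1 3 rfl
  have b4 := hf₂.1 4 rfl
  have b5 := hf₂.1 5 rfl
  have b6 := hf₂.1 6 rfl
  have b7 := hf₂.1 7 rfl
  have b30 := hf₂.1 30 rfl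
  have bm0 := hf₂.2 0 rfl
  have bm1 := hf₂.2 1 rfl
  have bm5 := hf₂.2 5 rfl
  simp [a0, a3, a4, a5, a6, a7, am0, am1, am5, m0, m1, m5] at r22' b0 b3 b4 b5 b6 b7 b30 bm0 bm1 bm5
  refine Runs.assign_seq (v := M) (by simp [b0, b3, b5, b6, s0, s3, s5, s6, r22', hM]) (by omega) ?_
  refine Runs.seq (Runs.forLt (I := fun k υ => (υ.reg 30, υ.mem 5) =
    (decodeStep N b t (σ.mem 0) (σ.mem 1))^[k] (bitsNum (σ.mem 1) (2 * b) (2 * t), 0)) n (by omega)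
    ?_ ?_ ?_) ?_
  · simp [b30, bm5]
    exact funext h5
  · intro k υ _ _ hg
    simpa [b6, s6] using hg.1 6 rfl
  · intro k hk υ hI h32 hg
    have c0 := hg.1 0 rfl
    have c3 := hg.1 3 rfl
    have c4 := hg.1 4 rfl
    have c5 := hg.1 5 rfl
    have c6 := hg.1 6 rfl
    have c7 := hg.1 7 rfl
    have cm0 := hg.2 0 rfl
    have cm1 := hg.2 1 rfl
    simp [b0, b3, b4, b5, b6, b7, bm0, bm1] at c0 c3 c4 c5 c6 c7 cm0 cm1
    refine Runs.mono (runs_decodeStepProg (hs.congr c0 c3 c4 c5 c6 c7) htN hbt hb1 (by omega)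
      (by omega) (by simpa [cm0] using h0) (by simpa [cm1] using h1)) le_rfl ?_
    intro ω hω hh
    refine ⟨(hh.1 32 rfl).trans h32, ?_⟩
    rw [Function.iterate_succ_apply', ← hI, ← cm0, ← cm1, ← hω]
    simp
  · rintro υ ⟨-, hI⟩ hg
    have d31 := hg.1 31 rfl
    simp at d31
    have hI5 : υ.mem 5 = decodeBits N b t n (σ.mem 0) (σ.mem 1) := congrArg Prod.snd hI
    -- The message is assembled in array `5`, because array `0` is still needed for hashing; only
    -- now is it copied to the output.
    refine Runs.seq (Runs.forLt (l := 1) (I := fun k ω => ∀ j < k,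
      ω.mem 0 j = decodeBits N b t n (σ.mem 0) (σ.mem 1) j) M (by omega) ?_ ?_ ?_) ?_
    · simp
    · intro k ω _ _ hh
      simpa [d31] using hh.1 31 rfl
    · intro k hk ω hI' h32 hh
      have e5 := hh.2 5 rfl
      refine Runs.store (j := k) (v := decodeBits N b t n (σ.mem 0) (σ.mem 1) k) (by simp [h32])
        (by simp [h32, e5, hI5])
        ((decodeBits_le _ _ _).trans_lt (Nat.one_lt_two_pow (by omega))) ⟨by simp [h32], ?_⟩
      intro j hj
      simp only [State.setReg_mem, State.setMem_mem, if_true, Function.update_apply]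
      split_ifs with hjk
      · rw [hjk]
      · exact hI' j (by omega)
    · rintro ω ⟨-, hω⟩ hh
      have e31 := hh.1 31 rfl
      refine Runs.assign (v := M) (by simp [e31, d31]) (by omega) ⟨by simp, ?_⟩
      simpa using hω

end RAM

/-! ### Free coordinates and good seeds -/

/-- For every block in use, every hash value is attained by changing the block in its free
coordinates `S p` only. -/
def IsGoodSeed (b t n : ℕ) (S : ℕ → Finset ℕ) (A : ℕ → ℕ) : Prop :=
  ∀ p < n, 3 * t < (S p).card → ∀ T < 2 ^ ((S p).card - t), ∀ W : ℕ → ℕ,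
    ∃ x < 2 ^ b, ∀ W' : ℕ → ℕ,
      (∀ j < b, W' (p * b + j) = if j ∈ S p then x / 2 ^ j % 2 else W (p * b + j)) →
      hashNum b W' A (p * b) ((S p).card - t) = T

/-- The free coordinates of block `p`, where `F` marks the frozen coordinates. -/
def freeSet (b : ℕ) (F : ℕ → ℕ) (p : ℕ) : Finset ℕ :=
  (Finset.range b).filter fun j => F (p * b + j) = 0

theorem freeSet_subset (b : ℕ) (F : ℕ → ℕ) (p : ℕ) : freeSet b F p ⊆ Finset.range b :=
  Finset.filter_subset _ _

theorem card_freeSet_le (b : ℕ) (F : ℕ → ℕ) (p : ℕ) : (freeSet b F p).card ≤ b := by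
  simpa using Finset.card_le_card (freeSet_subset b F p)

theorem mem_freeSet {b j p : ℕ} {F : ℕ → ℕ} (hj : j < b) :
    j ∈ freeSet b F p ↔ F (p * b + j) = 0 := by
  simp [freeSet, hj]

namespace RAM

/-! ### The encoder -/

/-- Puts the bits of `reg 38` into the free coordinates of the block at `reg 35`. -/
def insertProg : Prog :=
  .seq (.assign 40 (.reg 38))
    (.forLt 41 (.reg 5)
      (.seq (.cond (.load 3 (.reg 35 + .reg 41)) .skip
          (.store 0 (.reg 35 + .reg 41) (.reg 40 % .const 2)))
        (.assign 40 (.reg 40 / .const 2))))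

theorem runs_insertProg {B b : ℕ} {σ : State} (h5 : σ.reg 5 = b) (hb : b < 2 ^ B) :
    Runs B insertProg σ (5 * b + 3)
      (fun τ => ∀ i, τ.mem 0 i = if (σ.reg 35 ≤ i ∧ i < σ.reg 35 + b) ∧ σ.mem 3 i = 0 then
        σ.reg 38 / 2 ^ (i - σ.reg 35) % 2 else σ.mem 0 i) := by
  refine Runs.of_bounded fun hB hσ => ?_
  have hB0 : 1 < 2 ^ B := Nat.one_lt_two_pow (by omega)
  refine Runs.le (Runs.assign_seq (v := σ.reg 38) rfl (hσ.1 38)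
    (Runs.mono (Runs.forLt (l := 3)
      (fun k τ => τ.reg 40 = σ.reg 38 / 2 ^ k ∧
        ∀ i, τ.mem 0 i = if (σ.reg 35 ≤ i ∧ i < σ.reg 35 + k) ∧ σ.mem 3 i = 0 then
          σ.reg 38 / 2 ^ (i - σ.reg 35) % 2 else σ.mem 0 i)
      b hb ?_ ?_ ?_) le_rfl (fun τ h _ => h.2.2))) (by omega)
  · refine ⟨by simp, fun j => ?_⟩
    rw [if_neg (by omega)]
    rfl
  · intro k τ _ _ hf
    simpa [h5] using hf.1 5 rfl
  · rintro k hk τ ⟨h40, hm⟩ h41 hf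
    have h35 : τ.reg 35 = σ.reg 35 := by simpa using hf.1 35 rfl
    have hm3 : τ.mem 3 = σ.mem 3 := by simpa using hf.2 3 rfl
    refine Runs.seq (k := 2) (l := 1) (Runs.cond (k := 1) (Q := fun υ => ∀ i, υ.mem 0 i =
        if (σ.reg 35 ≤ i ∧ i < σ.reg 35 + (k + 1)) ∧ σ.mem 3 i = 0 then
          σ.reg 38 / 2 ^ (i - σ.reg 35) % 2 else σ.mem 0 i) ?_ ?_) ?_
    · intro hz
      refine Runs.skip fun i => ?_
      rw [hm]
      congr 1
      simp only [eq_iff_iff]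
      have : i = σ.reg 35 + k → σ.mem 3 i ≠ 0 := by
        rintro rfl
        simpa [h35, h41, hm3] using hz
      constructor
      · rintro ⟨h1, h2⟩
        exact ⟨by omega, h2⟩
      · rintro ⟨h1, h2⟩
        have := fun hi => this hi h2
        exact ⟨by omega, h2⟩
    · intro hz
      refine Runs.store (j := σ.reg 35 + k) (v := σ.reg 38 / 2 ^ k % 2) (by simp [h35, h41])
        (by simp [h40]) ((Nat.mod_lt _ two_pos).trans_le hB0) fun i => ?_
      simp only [State.setMem_mem, if_true, Function.update_apply, hm]
      by_cases hi : i = σ.reg 35 + k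
      · subst hi
        have : σ.mem 3 (σ.reg 35 + k) = 0 := by simpa [h35, h41, hm3] using hz
        simp [this]
      · rw [if_neg hi]
        congr 1
        simp only [eq_iff_iff]
        refine and_congr_left fun _ => ?_
        omega
    · intro υ hυ hg
      have g40 : υ.reg 40 = τ.reg 40 := hg.1 40 rfl
      have g41 : υ.reg 41 = τ.reg 41 := hg.1 41 rfl
      refine Runs.assign (v := σ.reg 38 / 2 ^ (k + 1))
        (by simp [g40, h40, Nat.div_div_eq_div_mul, pow_succ])
        ((Nat.div_le_self _ _).trans_lt (hσ.1 38)) ⟨by simp [g41, h41], by simp, by simpa using hυ⟩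

/-- Searches for a content of the free coordinates of the block at `reg 35` for which the first
`reg 11` bits of the hash value are `reg 37`; `reg 39` shows the success. -/
def searchProg : Prog :=
  .seq (.assign 10 (.reg 35)) (.seq (.assign 38 (.const 0)) (.seq (.assign 39 (.const 0))
    (.loop (.op .eq (.reg 39) (.const 0) * .op .lt (.reg 38) (.reg 46))
      (.seq insertProg
        (.seq hashProg
          (.seq (.assign 39 (.op .eq (.reg 12) (.reg 37)))
            (.assign 38 (.reg 38 + .const 1))))))))

/-- The flag in `reg 39` is sound, since it certifies the hash value, and complete, since it is set
if some `x` works. The candidates are strings for the whole block, whose bits at frozen positions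
are ignored; thus at most `2 ^ b` trials are made. -/
theorem runs_searchProg {B b κ p : ℕ} {σ : State} (h5 : σ.reg 5 = b) (h35 : σ.reg 35 = p * b)
    (h11 : σ.reg 11 = κ) (h46 : σ.reg 46 = 2 ^ b) (hκ : κ ≤ b) (hb : b < B)
    (h0 : ∀ j, σ.mem 0 j ≤ 1) (h1 : ∀ j, σ.mem 1 j ≤ 1) :
    Runs B searchProg σ (2 ^ b * (3 * b * b + 12 * b + 10) + 4)
      (fun τ => (∀ i, ((i < p * b ∨ (p + 1) * b ≤ i) ∨ σ.mem 3 i ≠ 0) →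
          τ.mem 0 i = σ.mem 0 i) ∧
        (∀ i, τ.mem 0 i ≤ 1) ∧ τ.reg 39 ≤ 1 ∧
        (τ.reg 39 ≠ 0 → hashNum b (τ.mem 0) (σ.mem 1) (p * b) κ = σ.reg 37) ∧
        ((∃ x < 2 ^ b, ∀ W' : ℕ → ℕ, (∀ j < b, W' (p * b + j) =
            if j ∈ freeSet b (σ.mem 3) p then x / 2 ^ j % 2 else σ.mem 0 (p * b + j)) →
          hashNum b W' (σ.mem 1) (p * b) κ = σ.reg 37) → τ.reg 39 = 1)) := by
  refine Runs.of_bounded fun hB hσ => ?_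
  have hB0 : 1 < 2 ^ B := Nat.one_lt_two_pow (by omega)
  have hX : 2 ^ b < 2 ^ B := Nat.pow_lt_pow_right (by norm_num) hb
  have hbB : b < 2 ^ B := hb.trans Nat.lt_two_pow_self
  have hsucc : (p + 1) * b = p * b + b := by ring
  refine Runs.le (Runs.assign_seq (v := p * b) (by simp [h35]) (h35 ▸ hσ.1 35)
    (Runs.assign_seq (v := 0) rfl (by omega) (Runs.assign_seq (v := 0) rfl (by omega)
    (Runs.mono (Runs.loop (l := 3 * b * b + 12 * b + 9) (fun k τ => k ≤ 2 ^ b ∧ τ.reg 38 = k ∧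
      (∀ i, ((i < p * b ∨ (p + 1) * b ≤ i) ∨ σ.mem 3 i ≠ 0) → τ.mem 0 i = σ.mem 0 i) ∧
      (∀ i, τ.mem 0 i ≤ 1) ∧ τ.reg 39 ≤ 1 ∧
      (τ.reg 39 ≠ 0 → hashNum b (τ.mem 0) (σ.mem 1) (p * b) κ = σ.reg 37) ∧
      (τ.reg 39 = 0 → ∀ x < k, ¬ ∀ W' : ℕ → ℕ, (∀ j < b, W' (p * b + j) =
            if j ∈ freeSet b (σ.mem 3) p then x / 2 ^ j % 2 else σ.mem 0 (p * b + j)) →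
          hashNum b W' (σ.mem 1) (p * b) κ = σ.reg 37)) (2 ^ b) ?_ ?_) le_rfl ?_)))) ?_
  · refine ⟨by simp, by simp, by simp, by simpa using h0, by simp, by simp, by simp⟩
  · rintro k τ ⟨hk, r38, hW, hW1, r39, hT, hbad⟩ hf hz
    have g46 : τ.reg 46 = 2 ^ b := by simpa [h46] using hf.1 46 rfl
    have g5 : τ.reg 5 = b := by simpa [h5] using hf.1 5 rfl
    have g35 : τ.reg 35 = p * b := by simpa [h35] using hf.1 35 rfl
    have g11 : τ.reg 11 = κ := by simpa [h11] using hf.1 11 rfl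
    have g10 : τ.reg 10 = p * b := by simpa using hf.1 10 rfl
    have g37 : τ.reg 37 = σ.reg 37 := by simpa using hf.1 37 rfl
    have gm1 : τ.mem 1 = σ.mem 1 := by simpa using hf.2 1 rfl
    have gm3 : τ.mem 3 = σ.mem 3 := by simpa using hf.2 3 rfl
    have hk' : τ.reg 39 = 0 ∧ k < 2 ^ b := by
      simp only [Expr.eval_mul, Expr.eval_eq, Expr.eval_lt, Expr.eval_reg, Expr.eval_const, g46,
        r38] at hz
      by_contra hc
      rw [not_and_or] at hc
      rcases hc with hc | hc <;> simp [hc] at hz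
    refine ⟨hk'.2, Runs.le (Runs.seq (runs_insertProg g5 hbB) (l := 3 * b * b + 7 * b + 6)
      fun υ hυ hg => ?_) (by ring_nf; omega)⟩
    simp only [g35, gm3, r38] at hυ
    have i5 := hg.1 5 rfl
    have i10 := hg.1 10 rfl
    have i11 := hg.1 11 rfl
    have i37 := hg.1 37 rfl
    have i38 := hg.1 38 rfl
    have im1 := hg.2 1 rfl
    simp only [g5, g10, g11, g37, r38, gm1] at i5 i10 i11 i37 i38 im1
    have hυ1 : ∀ i, υ.mem 0 i ≤ 1 := fun i => by
      rw [hυ]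
      split_ifs
      · exact Nat.lt_succ_iff.1 (Nat.mod_lt _ two_pos)
      · exact hW1 i
    refine Runs.le (k := κ * (3 * b + 7) + 4 + (1 + 1))
      (Runs.seq (Runs.le (runs_hashProg hυ1 (by simpa [im1] using h1)
        (by omega) (by omega)) ?_) ?_) (by nlinarith)
    · rw [i5, i11]
    intro ω r12 hh
    rw [i5, i10, i11, im1] at r12
    have j37 := (hh.1 37 rfl).trans i37
    have j38 := (hh.1 38 rfl).trans i38
    have jm0 : ω.mem 0 = υ.mem 0 := hh.2 0 rfl
    refine Runs.assign_seq (v := if hashNum b (υ.mem 0) (σ.mem 1) (p * b) κ = σ.reg 37 then 1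
      else 0) (by simp [r12, j37]) (by split_ifs <;> omega)
      (Runs.assign (v := k + 1) (by simp [j38]) (by omega)
        ⟨by omega, by simp, ?_, by simpa [jm0] using hυ1, ?_, ?_, ?_⟩)
    · intro i hi
      simp only [State.setReg_mem, jm0]
      rw [hυ, if_neg (by omega), hW i hi]
    · simp only [State.setReg_reg]
      split_ifs <;> simp_all
    · simp [jm0]
    · intro hz' x hx hgood
      have hne : hashNum b (υ.mem 0) (σ.mem 1) (p * b) κ ≠ σ.reg 37 := by
        intro he
        simp [he] at hz'
      rcases Nat.lt_succ_iff_lt_or_eq.1 hx with hx | rfl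
      · exact hbad hk'.1 x hx hgood
      -- The content just tested is one of the vectors `W'` that `x` describes, so its hash value
      -- would have been right.
      · refine hne (hgood _ fun j hj => ?_)
        rw [hυ]
        by_cases hF : σ.mem 3 (p * b + j) = 0
        · rw [if_pos ⟨by omega, hF⟩, if_pos ((mem_freeSet hj).2 hF), Nat.add_sub_cancel_left]
        · rw [if_neg (by tauto), if_neg (by rwa [mem_freeSet hj]), hW _ (Or.inr hF)]
  · rintro τ ⟨hz, k, -, hk, r38, hW, hW1, r39, hT, hbad⟩ hf
    refine ⟨hW, hW1, r39, hT, ?_⟩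
    rintro ⟨x, hx, hgood⟩
    by_contra hne
    have hzero : τ.reg 39 = 0 := by omega
    have g46 : τ.reg 46 = 2 ^ b := by simpa [h46] using hf.1 46 rfl
    have hkX : ¬ k < 2 ^ b := by
      intro hlt
      simp [hzero, r38, g46, hlt] at hz
    exact hbad hzero x (by omega) hgood
  · rw [show 3 * b * b + 12 * b + 9 + 1 = 3 * b * b + 12 * b + 10 from rfl]
    omega

/-- Stores the next message bits, and the description of the last block in use, in a block. -/
def useBlockProg : Prog :=
  .seq (.assign 11 (.reg 36 - .reg 3))
    (.seq (.assign 20 (.reg 33))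
      (.seq (.assign 21 (.reg 11 - (.reg 3 + .reg 3)))
        (.seq (packProg 2)
          (.seq (.assign 37 (.reg 30 + .reg 7 * .reg 22))
            (.seq searchProg
              (.seq (.assign 44 (.reg 44 * .reg 39))
                (.seq (.assign 30 (.reg 33 * .reg 0 + (.reg 35 + .reg 11)))
                  (.assign 33 (.reg 33 + .reg 21)))))))))

/-- Processes block `reg 34`. -/
def blockProg : Prog :=
  .seq (.assign 35 (.reg 34 * .reg 5))
    (.seq (.assign 36 (.const 0))
      (.seq (.forLt 41 (.reg 5)
          (.assign 36 (.reg 36 + (.const 1 - .load 3 (.reg 35 + .reg 41)))))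
        (.cond (.op .lt (.const 3 * .reg 3) (.reg 36)) useBlockProg .skip)))

/-- The effect of `blockProg` on block `p`. -/
structure BlockStep (N b t n p : ℕ) (σ τ : State) : Prop where
  chain : (τ.reg 30, τ.reg 33) = blockChain N b t (fun p => (freeSet b (σ.mem 3) p).card) (p + 1)
  mem0 : ∀ i, ((i < p * b ∨ (p + 1) * b ≤ i) ∨ σ.mem 3 i ≠ 0) → τ.mem 0 i = σ.mem 0 i
  mem0_le : ∀ i, τ.mem 0 i ≤ 1
  reg44_le : τ.reg 44 ≤ 1
  reg44 : τ.reg 44 ≠ 0 → σ.reg 44 ≠ 0 ∧ (3 * t < (freeSet b (σ.mem 3) p).card →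
    hashNum b (τ.mem 0) (σ.mem 1) (p * b) ((freeSet b (σ.mem 3) p).card - t) =
      blockTarget N b t (fun p => (freeSet b (σ.mem 3) p).card) (σ.mem 2) p)
  good : IsGoodSeed b t n (freeSet b (σ.mem 3)) (σ.mem 1) → σ.reg 44 = 1 → τ.reg 44 = 1

theorem runs_useBlockProg {B q N t b n p f : ℕ} {σ : State} (hs : IsSetup q N σ)
    (htN : t = N.size) (hbt : b = 6 * q * t) (hnb : n = N / b) (ht : 1 ≤ t) (hb : 4 * b ≤ B)
    (hb' : 2 * t ≤ b) (h0 : ∀ j, σ.mem 0 j ≤ 1) (h1 : ∀ j, σ.mem 1 j ≤ 1)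
    (h2 : ∀ j, σ.mem 2 j ≤ 1) (hp : p < n) (h35 : σ.reg 35 = p * b) (h36 : σ.reg 36 = f)
    (hf : f = (freeSet b (σ.mem 3) p).card) (hft : 3 * t < f)
    (h46 : σ.reg 46 = 2 ^ b) (h44 : σ.reg 44 ≤ 1)
    (hc : (σ.reg 30, σ.reg 33) =
      blockChain N b t (fun p => (freeSet b (σ.mem 3) p).card) p) :
    Runs B useBlockProg σ (2 ^ b * (3 * b * b + 12 * b + 10) + 4 * b + 15)
      (BlockStep N b t n p σ) := by
  refine Runs.of_bounded fun hB hσ => ?_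
  set fr : ℕ → ℕ := fun p => (freeSet b (σ.mem 3) p).card with hfr
  have hfb : ∀ p, fr p ≤ b := card_freeSet_le b _
  have hfp : fr p = f := hf.symm
  have hfb' : f ≤ b := hfp ▸ hfb p
  have hnN : n * b ≤ N := hnb ▸ Nat.div_mul_le_self _ _
  have hN : N < 2 ^ t := htN ▸ Nat.lt_size_self N
  have hbB : b < 2 ^ B := (Nat.lt_two_pow_self (n := b)).trans_le
    (Nat.pow_le_pow_right (by norm_num) (by omega))
  have htB : 2 ^ (2 * t) ≤ 2 ^ B := Nat.pow_le_pow_right (by norm_num) (by omega)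
  have hB0 : 1 < 2 ^ B := Nat.one_lt_two_pow (by omega)
  obtain ⟨-, -, -, hpos, hz⟩ := blockChain_succ_fst ht hfb hnN hp (by rw [hfp]; exact hft)
  have hy' := blockChain_fst_lt ht hfb hnN hN (p := p + 1) hp
  have hT := blockTarget_lt ht hfb hnN hN h2 hp (by rw [hfp]; exact hft)
  have hsucc : blockChain N b t fr (p + 1) = ((blockChain N b t fr p).2 * N + (p * b + (f - t)),
      (blockChain N b t fr p).2 + (f - t - 2 * t)) := by
    rw [blockChain, hfp, if_pos hft]
  have hpos' := blockChain_snd_le (N := N) (t := t) hfb (p + 1)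
  have hpn : (p + 1) * b ≤ N := (Nat.mul_le_mul_right _ hp).trans hnN
  rw [hsucc] at hy' hpos'
  rw [hfp] at hT hz
  have hNB : N < 2 ^ B := hs.reg0 ▸ hσ.1 0
  have hTB : blockTarget N b t fr (σ.mem 2) p < 2 ^ B :=
    hT.trans_le (Nat.pow_le_pow_right (by norm_num) (by omega))
  have e30 : σ.reg 30 = (blockChain N b t fr p).1 := congrArg Prod.fst hc
  have e33 : σ.reg 33 = (blockChain N b t fr p).2 := congrArg Prod.snd hc
  have s0 := hs.reg0
  have s3 := hs.reg3
  have s5 := hs.reg5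
  have s7 := hs.reg7
  rw [← htN] at s3 s5 s7
  rw [← hbt] at s5
  refine Runs.le (Runs.assign_seq (v := f - t) (by simp [h36, s3]) (by omega)
    (Runs.assign_seq (v := (blockChain N b t fr p).2) (by simp [e33]) (by omega)
      (Runs.assign_seq (v := f - t - 2 * t) (by simp [s3]; omega) (by omega)
        (Runs.seq (Runs.le (runs_packProg (by simpa using h2) (by simp; omega))
          (by simp; omega : _ ≤ 4 * b + 4)) (l := 2 ^ b * (3 * b * b + 12 * b + 10) + 8) ?_))))
    (by omega)
  intro τ r22 hg
  have g0 := hg.1 0 rfl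
  have g5 := hg.1 5 rfl
  have g7 := hg.1 7 rfl
  have g11 := hg.1 11 rfl
  have g21 := hg.1 21 rfl
  have g30 := hg.1 30 rfl
  have g33 := hg.1 33 rfl
  have g35 := hg.1 35 rfl
  have g44 := hg.1 44 rfl
  have g46 := hg.1 46 rfl
  have gm0 := hg.2 0 rfl
  have gm1 := hg.2 1 rfl
  have gm3 := hg.2 3 rfl
  simp [s0, s5, s7, e30, e33, h35, h46] at r22 g0 g5 g7 g11 g21 g30 g33 g35 g44 g46 gm0 gm1 gm3
  refine Runs.le (k := 1 + (2 ^ b * (3 * b * b + 12 * b + 10) + 4 + (1 + (1 + 1))))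
    (Runs.assign_seq (v := blockTarget N b t fr (σ.mem 2) p)
    (by simp [g30, g7, r22, blockTarget, hfp]) hTB
    (Runs.seq (runs_searchProg (b := b) (κ := f - t) (p := p) (by simp [g5]) (by simp [g35])
      (by simp [g11]) (by simp [g46]) (by omega) (by omega) (by simpa [gm0] using h0)
      (by simpa [gm1] using h1)) ?_)) (by omega)
  rintro υ ⟨hW, hW1, h39, hT', hgood⟩ hh
  have k0 := hh.1 0 rfl
  have k11 := hh.1 11 rfl
  have k21 := hh.1 21 rfl
  have k33 := hh.1 33 rfl
  have k35 := hh.1 35 rfl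
  have k44 := hh.1 44 rfl
  simp [g0, g11, g21, g33, g35, g44] at k0 k11 k21 k33 k35 k44
  simp only [State.setReg_mem, State.setReg_reg, gm0, gm1, gm3, if_true] at hW hT' hgood
  have hprod : σ.reg 44 * υ.reg 39 ≤ 1 := Nat.mul_le_mul h44 h39
  refine Runs.assign_seq (v := σ.reg 44 * υ.reg 39) (by simp [k44]) (by omega)
    (Runs.assign_seq (v := (blockChain N b t fr p).2 * N + (p * b + (f - t)))
      (by simp [k33, k0, k35, k11]) (hy'.trans_le htB)
      (Runs.assign (v := (blockChain N b t fr p).2 + (f - t - 2 * t)) (by simp [k33, k21])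
        (by simp only at hpos'; omega) ?_))
  refine ⟨?_, by simpa using hW, by simpa using hW1, by simpa using hprod, ?_, ?_⟩
  · simp only [State.setReg_reg]
    rw [← hfr, hsucc]
    simp
  · simp only [State.setReg_reg, State.setReg_mem]
    intro hne
    simp at hne
    refine ⟨hne.1, fun _ => ?_⟩
    rw [← hf, hT' hne.2]
  -- A good seed makes the target attainable from the present content of the block, whatever that
  -- is, and so completeness of the search applies.
  · intro hA h441
    have h39' : υ.reg 39 = 1 := by
      refine hgood ?_
      have := hA p hp (by rw [← hf]; exact hft) (blockTarget N b t fr (σ.mem 2) p)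
        (by rw [← hf]; exact hT) (σ.mem 0)
      rwa [← hf] at this
    simp [h441, h39']

theorem runs_blockProg {B q N t b n p : ℕ} {σ : State} (hs : IsSetup q N σ)
    (htN : t = N.size) (hbt : b = 6 * q * t) (hnb : n = N / b) (ht : 1 ≤ t) (hb : 4 * b ≤ B)
    (hb' : 2 * t ≤ b) (h0 : ∀ j, σ.mem 0 j ≤ 1) (h1 : ∀ j, σ.mem 1 j ≤ 1)
    (h2 : ∀ j, σ.mem 2 j ≤ 1) (hp : p < n) (h34 : σ.reg 34 = p)
    (h46 : σ.reg 46 = 2 ^ b) (h44 : σ.reg 44 ≤ 1)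
    (hc : (σ.reg 30, σ.reg 33) =
      blockChain N b t (fun p => (freeSet b (σ.mem 3) p).card) p) :
    Runs B blockProg σ (2 ^ b * (3 * b * b + 12 * b + 10) + 7 * b + 20)
      (BlockStep N b t n p σ) := by
  refine Runs.of_bounded fun hB hσ => ?_
  have hnN : n * b ≤ N := hnb ▸ Nat.div_mul_le_self _ _
  have hpn : (p + 1) * b ≤ N := (Nat.mul_le_mul_right _ hp).trans hnN
  rw [add_one_mul] at hpn
  have hNB : N < 2 ^ B := hs.reg0 ▸ hσ.1 0
  have s3 := hs.reg3
  have s5 := hs.reg5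
  rw [← htN] at s3 s5
  rw [← hbt] at s5
  refine Runs.le (k := 1 + (1 + (b * (1 + 2) + 2 +
    (2 ^ b * (3 * b * b + 12 * b + 10) + 4 * b + 15 + 1))))
    (Runs.assign_seq (v := p * b) (by simp [h34, s5]) (by omega)
    (Runs.assign_seq (v := 0) rfl (by omega) (Runs.seq (Runs.forLt (l := 1)
      (fun k τ => τ.reg 36 = ∑ j ∈ Finset.range k, if σ.mem 3 (p * b + j) = 0 then 1 else 0) b
      (by omega) ?_ ?_ ?_) ?_))) (by omega)
  · simp
  · intro k τ _ _ hf
    simpa [s5] using hf.1 5 rfl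
  · intro k hk τ h36 h41 hf
    have g35 := hf.1 35 rfl
    have gm3 := hf.2 3 rfl
    simp at g35 gm3
    have hle : ∑ j ∈ Finset.range (k + 1), (if σ.mem 3 (p * b + j) = 0 then 1 else 0) ≤ k + 1 := by
      refine (Finset.sum_le_card_nsmul _ _ 1 fun i _ => ?_).trans (by simp)
      split_ifs <;> omega
    refine Runs.assign (v := ∑ j ∈ Finset.range (k + 1),
      if σ.mem 3 (p * b + j) = 0 then 1 else 0) ?_ (by omega) ⟨by simp [h41], by simp⟩
    rw [Finset.sum_range_succ, ← h36]
    simp [h41, g35, gm3]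
    split_ifs <;> omega
  · rintro τ ⟨-, h36⟩ hf
    have hcard : τ.reg 36 = (freeSet b (σ.mem 3) p).card := by
      rw [h36, freeSet, Finset.card_filter]
    have f0 := hf.1 0 rfl
    have f3 := hf.1 3 rfl
    have f4 := hf.1 4 rfl
    have f5 := hf.1 5 rfl
    have f6 := hf.1 6 rfl
    have f7 := hf.1 7 rfl
    have f30 := hf.1 30 rfl
    have f33 := hf.1 33 rfl
    have f35 := hf.1 35 rfl
    have f44 := hf.1 44 rfl
    have f46 := hf.1 46 rfl
    have m0 := hf.2 0 rfl
    have m1 := hf.2 1 rfl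
    have m2 := hf.2 2 rfl
    have m3 := hf.2 3 rfl
    simp at f0 f3 f4 f5 f6 f7 f30 f33 f35 f44 f46 m0 m1 m2 m3
    refine Runs.cond (fun hz => ?_) (fun hz => ?_)
    · have hft : 3 * t < τ.reg 36 := by
        by_contra hc
        rw [Expr.eval_lt, if_neg (by simpa [f3, s3] using hc)] at hz
        exact hz rfl
      refine Runs.mono (runs_useBlockProg (hs.congr f0 f3 f4 f5 f6 f7) htN hbt hnb ht hb hb'
        (by simpa [m0] using h0) (by simpa [m1] using h1) (by simpa [m2] using h2) hp f35 rfl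
        (by rw [m3]; exact hcard) hft (by rw [f46, h46]) (by rw [f44]; exact h44)
        (by rw [f30, f33, m3]; exact hc)) le_rfl ?_
      rintro υ ⟨a1, a2, a3, a4, a5, a6⟩ _
      rw [m3] at a1 a2 a5 a6
      rw [m0] at a2
      rw [m1, m2, f44] at a5
      rw [m1, f44] at a6
      exact ⟨a1, a2, a3, a4, a5, a6⟩
    · have hft : ¬ 3 * t < τ.reg 36 := by
        intro hc
        rw [Expr.eval_lt, if_pos (by simpa [f3, s3] using hc)] at hz
        exact one_ne_zero hz
      rw [hcard] at hft
      refine Runs.le (Runs.skip ⟨?_, fun i _ => by rw [m0], by simpa [m0] using h0,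
        by rw [f44]; exact h44, fun h => ⟨by rwa [f44] at h, fun h' => absurd h' hft⟩,
        fun _ h => by rw [f44, h]⟩) (by omega)
      rw [f30, f33, hc, blockChain, if_neg hft]

/-- Tries the seed `reg 43`; `reg 44` shows the success. -/
def trySeedProg : Prog :=
  .seq (.assign 20 (.const 0))
    (.seq (.assign 21 (.reg 5 + .reg 5))
      (.seq (.assign 22 (.reg 43))
        (.seq (unpackProg 1)
          (.seq (.assign 44 (.const 1))
            (.seq (.assign 30 (.const 0))
              (.seq (.assign 33 (.const 0))
                (.seq (.forLt 34 (.reg 6) blockProg)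
                  (.assign 43 (.reg 43 + .const 1)))))))))

/-- Every block in use has the hash value that it has to have. -/
def BlocksFit (N b t n : ℕ) (F m W A : ℕ → ℕ) : Prop :=
  ∀ p < n, 3 * t < (freeSet b F p).card →
    hashNum b W A (p * b) ((freeSet b F p).card - t) =
      blockTarget N b t (fun p => (freeSet b F p).card) m p

/-- The effect of `trySeedProg`. -/
structure SeedStep (N b t n : ℕ) (σ τ : State) : Prop where
  mem0 : ∀ i, σ.mem 3 i ≠ 0 → τ.mem 0 i = σ.mem 0 i
  mem0_le : ∀ i, τ.mem 0 i ≤ 1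
  mem1_le : ∀ i, τ.mem 1 i ≤ 1
  mem1 : ∀ j < 2 * b, τ.mem 1 j = σ.reg 43 / 2 ^ j % 2
  reg43 : τ.reg 43 = σ.reg 43 + 1
  reg44_le : τ.reg 44 ≤ 1
  reg44 : τ.reg 44 ≠ 0 →
    τ.reg 30 = (blockChain N b t (fun p => (freeSet b (σ.mem 3) p).card) n).1 ∧
      BlocksFit N b t n (σ.mem 3) (σ.mem 2) (τ.mem 0) (τ.mem 1)
  good : IsGoodSeed b t n (freeSet b (σ.mem 3)) (τ.mem 1) → τ.reg 44 = 1

/-- Free cells may still hold leftovers of earlier seeds. This is harmless: frozen cells are never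
changed, and `IsGoodSeed` quantifies over all contents. -/
theorem runs_trySeedProg {B q N t b n : ℕ} {σ : State} (hs : IsSetup q N σ)
    (htN : t = N.size) (hbt : b = 6 * q * t) (hnb : n = N / b) (ht : 1 ≤ t) (hb : 4 * b ≤ B)
    (hb' : 2 * t ≤ b) (h0 : ∀ j, σ.mem 0 j ≤ 1) (h1 : ∀ j, σ.mem 1 j ≤ 1)
    (h2 : ∀ j, σ.mem 2 j ≤ 1) (h43 : σ.reg 43 < 2 ^ (2 * b)) (h46 : σ.reg 46 = 2 ^ b) :
    Runs B trySeedProg σ (n * (2 ^ b * (3 * b * b + 12 * b + 10) + 7 * b + 22) + 8 * b + 11)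
      (SeedStep N b t n σ) := by
  refine Runs.of_bounded fun hB hσ => ?_
  have hNB : N < 2 ^ B := hs.reg0 ▸ hσ.1 0
  have hnN : n ≤ N := hnb ▸ Nat.div_le_self _ _
  have hB0 : 1 < 2 ^ B := Nat.one_lt_two_pow (by omega)
  have hBB : B < 2 ^ B := Nat.lt_two_pow_self
  have h2b : 2 ^ (2 * b) < 2 ^ B := Nat.pow_lt_pow_right (by norm_num) (by omega)
  have s5 := hs.reg5
  have s6 := hs.reg6
  rw [← htN, ← hbt] at s5 s6
  rw [← hnb] at s6
  refine Runs.le (k := 1 + (1 + (1 + (8 * b + 2 + (1 + (1 + (1 +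
    (n * (2 ^ b * (3 * b * b + 12 * b + 10) + 7 * b + 20 + 2) + 2 + 1))))))))
    (Runs.assign_seq (v := 0) rfl (by omega)
    (Runs.assign_seq (v := 2 * b) (by simp [s5, two_mul]) (by omega)
      (Runs.assign_seq (v := σ.reg 43) (by simp) (by omega)
        (Runs.seq (Runs.le (runs_unpackProg (by simp; omega)) (by simp; omega)) ?_)))) (by
          rw [show 2 ^ b * (3 * b * b + 12 * b + 10) + 7 * b + 20 + 2 =
            2 ^ b * (3 * b * b + 12 * b + 10) + 7 * b + 22 from rfl]; omega)
  intro τ hm hf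
  have f0 := hf.1 0 rfl
  have f3 := hf.1 3 rfl
  have f4 := hf.1 4 rfl
  have f5 := hf.1 5 rfl
  have f6 := hf.1 6 rfl
  have f7 := hf.1 7 rfl
  have f43 := hf.1 43 rfl
  have f46 := hf.1 46 rfl
  have m0 := hf.2 0 rfl
  have m2 := hf.2 2 rfl
  have m3 := hf.2 3 rfl
  simp at hm f0 f3 f4 f5 f6 f7 f43 f46 m0 m2 m3
  have hA1 : ∀ j, τ.mem 1 j ≤ 1 := fun j => by
    rw [hm]
    split_ifs
    · exact Nat.lt_succ_iff.1 (Nat.mod_lt _ two_pos)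
    · exact h1 j
  refine Runs.assign_seq (v := 1) rfl hB0 (Runs.assign_seq (v := 0) rfl (by omega)
    (Runs.assign_seq (v := 0) rfl (by omega) (Runs.seq (Runs.forLt
      (fun k υ => (υ.reg 30, υ.reg 33) =
          blockChain N b t (fun p => (freeSet b (σ.mem 3) p).card) k ∧
        (∀ i, σ.mem 3 i ≠ 0 → υ.mem 0 i = σ.mem 0 i) ∧ (∀ i, υ.mem 0 i ≤ 1) ∧ υ.reg 44 ≤ 1 ∧
        (υ.reg 44 ≠ 0 → BlocksFit N b t k (σ.mem 3) (σ.mem 2) (υ.mem 0) (τ.mem 1)) ∧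
        (IsGoodSeed b t n (freeSet b (σ.mem 3)) (τ.mem 1) → υ.reg 44 = 1))
      n (by omega) ?_ ?_ ?_) ?_)))
  · refine ⟨by simp [blockChain], by simp [m0], by simpa [m0] using h0, by simp, ?_, by simp⟩
    exact fun _ p hp => absurd hp (Nat.not_lt_zero p)
  · intro k υ _ _ hg
    simpa [f6, s6] using hg.1 6 rfl
  · rintro k hk υ ⟨i1, i2, i3, i4, i5, i6⟩ h34 hg
    have g0 := hg.1 0 rfl
    have g3 := hg.1 3 rfl
    have g4 := hg.1 4 rfl
    have g5 := hg.1 5 rfl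
    have g6 := hg.1 6 rfl
    have g7 := hg.1 7 rfl
    have g46 := hg.1 46 rfl
    have n1 := hg.2 1 rfl
    have n2 := hg.2 2 rfl
    have n3 := hg.2 3 rfl
    simp [f0, f3, f4, f5, f6, f7, f46, m2, m3] at g0 g3 g4 g5 g6 g7 g46 n1 n2 n3
    refine Runs.mono (runs_blockProg (hs.congr g0 g3 g4 g5 g6 g7) htN hbt hnb ht hb hb' i3
      (by simpa [n1] using hA1) (by simpa [n2] using h2) hk h34 (by rw [g46, h46]) i4
      (by rw [n3]; exact i1)) le_rfl ?_
    rintro ω ⟨a1, a2, a3, a4, a5, a6⟩ hh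
    rw [n3] at a1 a2 a5 a6
    rw [n1, n2] at a5
    rw [n1] at a6
    refine ⟨(hh.1 34 rfl).trans h34, by simpa using a1, ?_, by simpa using a3, by simpa using a4,
      ?_, ?_⟩
    · intro i hi
      exact (a2 i (Or.inr hi)).trans (i2 i hi)
    · intro hne
      simp at hne
      obtain ⟨b1, b2⟩ := a5 hne
      intro p hp hft
      rcases Nat.lt_succ_iff_lt_or_eq.1 hp with hp | rfl
      -- Work on block `k` leaves the cells of the earlier blocks alone, so their hash values
      -- persist.
      · rw [← i5 b1 p hp hft]
        have hle := card_freeSet_le b (σ.mem 3) p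
        refine hashNum_congr (by omega) (fun j hj => a2 _ (Or.inl (Or.inl ?_))) fun _ _ => rfl
        have : (p + 1) * b ≤ k * b := Nat.mul_le_mul_right _ hp
        rw [add_one_mul] at this
        omega
      · exact b2 hft
    · intro hgood
      simpa using a6 hgood (i6 hgood)
  · rintro υ ⟨-, i1, i2, i3, i4, i5, i6⟩ hg
    have g43 := hg.1 43 rfl
    have n1 := hg.2 1 rfl
    simp [f43] at g43 n1
    refine Runs.assign (v := σ.reg 43 + 1) (by simp [g43]) (by omega)
      ⟨by simpa using i2, by simpa using i3, by simpa [n1] using hA1, ?_, by simp,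
        by simpa using i4, ?_, by simpa [n1] using i6⟩
    · intro j hj
      simp [n1, hm, hj]
    · intro hne
      simp at hne
      refine ⟨?_, by simpa [n1] using i5 hne⟩
      have := congrArg Prod.fst i1
      simpa using this

/-- The encoder. -/
def encoderProg (q : ℕ) : Prog :=
  .seq (setupProg q)
    (.seq (.assign 46 ((Expr.reg 4).powConst (6 * q)))
      (.seq (.assign 45 (.const 0))
        (.seq (.forLt 41 (.reg 0) (.seq (.store 3 (.reg 41) (.load 1 (.reg 41)))
            (.assign 45 (.reg 45 + .load 1 (.reg 41)))))
          (.seq (.assign 43 (.const 0))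
            (.seq (.assign 44 (.const 0))
              (.seq (.loop (.op .eq (.reg 44) (.const 0)) trySeedProg)
                (.seq (.assign 20 (.reg 5 + .reg 5))
                  (.seq (.assign 21 (.reg 3 + .reg 3))
                    (.seq (.assign 22 (.reg 30))
                      (.seq (unpackProg 1)
                        (.seq (.assign 20 (.reg 5 + .reg 5 + (.reg 3 + .reg 3)))
                          (.seq (.assign 21 (.reg 3))
                            (.seq (.assign 22 (.reg 45 - .const 1))
                              (.seq (unpackProg 1)
                                (.assign 1
                                  (.reg 5 + .reg 5 + (.reg 3 + .reg 3 + .reg 3)))))))))))))))))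

/-- The output of the encoder on the cover vector `V`, the characteristic vector `F` of the frozen
coordinates and the message `m`. -/
structure IsEncoding (N b t n : ℕ) (V F m : ℕ → ℕ) (τ : State) : Prop where
  reg0 : τ.reg 0 = N
  reg1 : τ.reg 1 = 2 * b + 3 * t
  mem0_le : ∀ i, τ.mem 0 i ≤ 1
  mem1_le : ∀ i, τ.mem 1 i ≤ 1
  mem0 : ∀ i, F i ≠ 0 → τ.mem 0 i = V i
  fit : BlocksFit N b t n F m (τ.mem 0) (τ.mem 1)
  chain : bitsNum (τ.mem 1) (2 * b) (2 * t) =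
    (blockChain N b t (fun p => (freeSet b F p).card) n).1
  count : bitsNum (τ.mem 1) (2 * b + 2 * t) t = ∑ j ∈ Finset.range N, F j - 1

theorem runs_encoderProg {B q N t b n : ℕ} {σ : State} (hN : σ.reg 0 = N)
    (htN : t = N.size) (hbt : b = 6 * q * t) (hnb : n = N / b) (ht : 1 ≤ t) (hb : 4 * b ≤ B)
    (hb' : 2 * t ≤ b) (h0 : ∀ j, σ.mem 0 j ≤ 1) (h1 : ∀ j, σ.mem 1 j ≤ 1)
    (h2 : ∀ j, σ.mem 2 j ≤ 1) (hF : ∀ j, N ≤ j → σ.mem 1 j = 0) (h3 : ∀ j, σ.mem 3 j = 0) :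
    Runs B (encoderProg q) σ
      (2 ^ (2 * b) * (n * (2 ^ b * (3 * b * b + 12 * b + 10) + 7 * b + 22) + 8 * b + 12) +
        4 * N + 15 * t + 24)
      (IsEncoding N b t n (σ.mem 0) (σ.mem 1) (σ.mem 2)) := by
  refine Runs.of_bounded fun hB hσ => ?_
  have hNB : N < 2 ^ B := hN ▸ hσ.1 0
  have hNt : N < 2 ^ t := htN ▸ Nat.lt_size_self N
  have hB0 : 1 < 2 ^ B := Nat.one_lt_two_pow (by omega)
  have hBB : B < 2 ^ B := Nat.lt_two_pow_self
  have hbB : 2 ^ b < 2 ^ B := Nat.pow_lt_pow_right (by norm_num) (by omega)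
  have hnN : n * b ≤ N := hnb ▸ Nat.div_mul_le_self _ _
  have hnt : n < 2 ^ t := (hnb ▸ Nat.div_le_self _ _ : n ≤ N).trans_lt hNt
  set S := freeSet b (σ.mem 1) with hS
  set C := n * (2 ^ b * (3 * b * b + 12 * b + 10) + 7 * b + 22) + 8 * b + 11 with hC
  -- This seed only serves to stop the search: the loop ends at `a₀` at the latest. A smaller seed
  -- is accepted too if it happens to suit the given message and cover vector.
  obtain ⟨a₀, ha₀, hgood⟩ := exists_seed hnt S (freeSet_subset b _)
  have hgood' : ∀ A : ℕ → ℕ, (∀ j < 2 * b, A j = a₀ / 2 ^ j % 2) → IsGoodSeed b t n S A :=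
    fun A hA p hp hft T hT W => hgood p hp (by omega) T hT W A (p * b) hA
  refine Runs.le (k := 3 * t + 6 + (1 + (1 + (N * (2 + 2) + 2 + (1 + (1 + (2 ^ (2 * b) * (C + 1) + 1
    + (1 + (1 + (1 + (8 * t + 2 + (1 + (1 + (1 + (4 * t + 2 + 1)))))))))))))))
    (Runs.seq (htN ▸ runs_setupProg hN (by omega) (by rw [← htN, ← hbt]; omega)) ?_)
    (by rw [show C + 1 = n * (2 ^ b * (3 * b * b + 12 * b + 10) + 7 * b + 22) + 8 * b + 12
          from rfl]
        omega)
  intro τ hs hf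
  have m0 : τ.mem 0 = σ.mem 0 := hf.2 0 rfl
  have m1 : τ.mem 1 = σ.mem 1 := hf.2 1 rfl
  have m2 : τ.mem 2 = σ.mem 2 := hf.2 2 rfl
  have m3 : τ.mem 3 = σ.mem 3 := hf.2 3 rfl
  have hcnt : ∀ k, ∑ j ∈ Finset.range k, σ.mem 1 j ≤ k := fun k =>
    (Finset.sum_le_card_nsmul _ _ 1 fun i _ => h1 i).trans (by simp)
  -- As `b = 6 * q * t`, this is the power of `2 ^ t` with the exponent `6 * q`, which does not
  -- depend on `N`; the program text may depend on `ε` only.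
  refine Runs.assign_seq (v := 2 ^ b)
    (by rw [Expr.eval_powConst, Expr.eval_reg, hs.reg4, ← htN, ← pow_mul, hbt]; congr 1; ring) hbB
    (Runs.assign_seq (v := 0) rfl (by omega) (Runs.seq (Runs.forLt (l := 2)
      (fun k υ => υ.reg 45 = ∑ j ∈ Finset.range k, σ.mem 1 j ∧
        ∀ j, υ.mem 3 j = if j < k then σ.mem 1 j else 0) N hNB ?_ ?_ ?_) ?_))
  · simp [m3, h3]
  · intro k υ _ _ hg
    simpa [hs.reg0] using hg.1 0 rfl
  · rintro k hk υ ⟨r45, hm3⟩ r41 hg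
    have n1 : υ.mem 1 = σ.mem 1 := by simpa [m1] using hg.2 1 rfl
    refine Runs.store_seq (j := k) (v := σ.mem 1 k) (by simp [r41]) (by simp [r41, n1]) (hσ.2 _ _)
      (Runs.assign (v := ∑ j ∈ Finset.range (k + 1), σ.mem 1 j) ?_
        ((hcnt _).trans_lt (by omega)) ⟨by simp [r41], by simp, fun j => ?_⟩)
    · simp [r41, r45, n1, Finset.sum_range_succ]
    · simp only [State.setReg_mem, State.setMem_mem, if_true, Function.update_apply, hm3]
      by_cases hj : j = k
      · subst hj
        simp
      · rw [if_neg hj]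
        congr 1
        simp only [eq_iff_iff]
        omega
  rintro υ ⟨-, r45, hm3⟩ hg
  -- The marks of the frozen cells are saved in array `3`, because array `1` will hold the seed.
  -- Beyond `N` both arrays are zero.
  have hm3' : υ.mem 3 = σ.mem 1 := funext fun j => by
    rw [hm3]
    split_ifs with hj
    · rfl
    · exact (hF j (by omega)).symm
  have g0 := hg.1 0 rfl
  have g3 := hg.1 3 rfl
  have g4 := hg.1 4 rfl
  have g5 := hg.1 5 rfl
  have g6 := hg.1 6 rfl
  have g7 := hg.1 7 rfl
  have g46 := hg.1 46 rfl
  have n0 := hg.2 0 rfl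
  have n1 := hg.2 1 rfl
  have n2 := hg.2 2 rfl
  simp [m0, m1, m2] at g0 g3 g4 g5 g6 g7 g46 n0 n1 n2
  refine Runs.assign_seq (v := 0) rfl (by omega) (Runs.assign_seq (v := 0) rfl (by omega)
    (Runs.seq (Runs.loop (l := C)
      (fun k ω => k ≤ 2 ^ (2 * b) ∧ ω.reg 43 = k ∧ (∀ i, ω.mem 0 i ≤ 1) ∧ (∀ i, ω.mem 1 i ≤ 1) ∧
        (∀ i, σ.mem 1 i ≠ 0 → ω.mem 0 i = σ.mem 0 i) ∧
        (ω.reg 44 = 0 → ∀ a < k, a ≠ a₀) ∧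
        (ω.reg 44 ≠ 0 → ω.reg 30 = (blockChain N b t (fun p => (S p).card) n).1 ∧
          BlocksFit N b t n (σ.mem 1) (σ.mem 2) (ω.mem 0) (ω.mem 1)))
      (2 ^ (2 * b)) ?_ ?_) ?_))
  · exact ⟨by positivity, by simp, by simpa [n0] using h0, by simpa [n1] using h1,
      by simp [n0], by simp, by simp⟩
  · rintro k ω ⟨hk, r43, i0, i1, i2, i3, i4⟩ hh hz
    have k0 := hh.1 0 rfl
    have k3 := hh.1 3 rfl
    have k4 := hh.1 4 rfl
    have k5 := hh.1 5 rfl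
    have k6 := hh.1 6 rfl
    have k7 := hh.1 7 rfl
    have k46 := hh.1 46 rfl
    have l2 := hh.2 2 rfl
    have l3 := hh.2 3 rfl
    simp [g0, g3, g4, g5, g6, g7, g46, n2, hm3'] at k0 k3 k4 k5 k6 k7 k46 l2 l3
    have hz' : ω.reg 44 = 0 := by
      by_contra hc
      simp [hc] at hz
    have hk' : k < 2 ^ (2 * b) := by
      by_contra hc
      exact i3 hz' a₀ (by omega) rfl
    refine ⟨hk', Runs.mono (runs_trySeedProg (hs.congr k0 k3 k4 k5 k6 k7) htN hbt hnb ht hb hb' i0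
      i1 (by simpa [l2] using h2) (by rw [r43]; exact hk') k46) le_rfl ?_⟩
    rintro ω' ⟨a1, a2, a3, a4, a5, a6, a7, a8⟩ _
    rw [l3] at a1 a7 a8
    rw [l2] at a7
    rw [r43] at a4 a5
    refine ⟨by omega, a5, a2, a3, fun i hi => (a1 i hi).trans (i2 i hi), ?_, a7⟩
    rintro hz'' a ha rfl
    rcases Nat.lt_succ_iff_lt_or_eq.1 ha with ha | rfl
    · exact i3 hz' a ha rfl
    · rw [a8 (hgood' _ a4)] at hz''
      exact one_ne_zero hz''
  · rintro ω ⟨hz, k, -, -, -, i0, i1, i2, -, i4⟩ hh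
    have hz' : ω.reg 44 ≠ 0 := by
      intro hc
      simp [hc] at hz
    obtain ⟨r30, hfit⟩ := i4 hz'
    have k0 := hh.1 0 rfl
    have k3 := hh.1 3 rfl
    have k5 := hh.1 5 rfl
    have k45 := hh.1 45 rfl
    simp [g0, g3, g5, hs.reg0, hs.reg3, hs.reg5, ← htN, ← hbt, r45] at k0 k3 k5 k45
    have hy := blockChain_fst_lt (f := fun p => (S p).card) ht (card_freeSet_le b _) hnN hNt
      (le_refl n)
    have htB : 2 ^ (2 * t) < 2 ^ B := Nat.pow_lt_pow_right (by norm_num) (by omega)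
    have hcN := hcnt N
    set y := (blockChain N b t (fun p => (S p).card) n).1 with hyd
    set cnt := ∑ j ∈ Finset.range N, σ.mem 1 j with hcd
    refine Runs.assign_seq (v := 2 * b) (by simp [k5, two_mul]) (by omega)
      (Runs.assign_seq (v := 2 * t) (by simp [k3, two_mul]) (by omega)
        (Runs.assign_seq (v := y) (by simp [r30]) (by omega)
          (Runs.seq (Runs.le (runs_unpackProg (by simp; omega)) (by simp; omega)) ?_)))
    intro ω₁ hm₁ hf₁
    have p0 := hf₁.1 0 rfl
    have p3 := hf₁.1 3 rfl
    have p5 := hf₁.1 5 rfl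
    have p45 := hf₁.1 45 rfl
    have q0 := hf₁.2 0 rfl
    simp [k0, k3, k5, k45] at hm₁ p0 p3 p5 p45 q0
    refine Runs.assign_seq (v := 2 * b + 2 * t) (by simp [p3, p5, two_mul]) (by omega)
      (Runs.assign_seq (v := t) (by simp [p3]) (by omega)
        (Runs.assign_seq (v := cnt - 1) (by simp [p45]) (by omega)
          (Runs.seq (Runs.le (runs_unpackProg (by simp; omega)) (by simp)) ?_)))
    intro ω₂ hm₂ hf₂
    have v0 := hf₂.1 0 rfl
    have v3 := hf₂.1 3 rfl
    have v5 := hf₂.1 5 rfl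
    have w0 := hf₂.2 0 rfl
    simp [p0, p3, p5, q0] at hm₂ v0 v3 v5 w0
    have hmod : ∀ x, x % 2 ≤ 1 := fun x => Nat.lt_succ_iff.1 (Nat.mod_lt _ two_pos)
    refine Runs.assign (v := 2 * b + 3 * t) (by simp [v5, v3]; ring) (by omega)
      ⟨by simp [v0], by simp, by simpa [w0] using i0, ?_, by simpa [w0] using i2, ?_, ?_, ?_⟩
    · intro i
      simp only [State.setReg_mem, hm₂, hm₁]
      split_ifs
      · exact hmod _
      · exact hmod _
      · exact i1 i
    · intro p hp hft
      rw [← hfit p hp hft]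
      have hle := card_freeSet_le b (σ.mem 1) p
      -- The description and the count are written behind the first `2 * b` cells, where the hash
      -- does not look.
      refine hashNum_congr (by omega) (fun j _ => by simp [w0]) fun j hj => ?_
      simp only [State.setReg_mem, hm₂, hm₁]
      rw [if_neg (by omega), if_neg (by omega)]
    · rw [bitsNum_congr (M' := fun j => y / 2 ^ j % 2) (off' := 0), bitsNum_digits,
        Nat.mod_eq_of_lt hy]
      intro j hj
      simp only [State.setReg_mem, hm₂, hm₁]
      rw [if_neg (by omega), if_pos (by omega)]
      simp
    · rw [bitsNum_congr (M' := fun j => (cnt - 1) / 2 ^ j % 2) (off' := 0), bitsNum_digits,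
        Nat.mod_eq_of_lt (by omega)]
      intro j hj
      simp only [State.setReg_mem, hm₂, hm₁]
      rw [if_pos (by omega)]
      simp

end RAM

/-! ### The code -/

theorem getD_ofFn_toNat {N : ℕ} (v : Fin N → Bool) (j : ℕ) :
    ((List.ofFn v).getD j false).toNat = if h : j < N then (v ⟨j, h⟩).toNat else 0 := by
  rw [List.getD_eq_getElem?_getD, List.getElem?_ofFn]
  split_ifs <;> rfl

theorem toNat_decide_eq_one {x : ℕ} (hx : x ≤ 1) : (decide (x = 1)).toNat = x := by
  rcases Nat.le_one_iff_eq_zero_or_eq_one.1 hx with rfl | rfl <;> rfl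

namespace RAM

theorem startState_bounded {B : ℕ} (hB : 1 ≤ B) {xs : List (List Bool)}
    (h : ∀ x ∈ xs, x.length < 2 ^ B) : (startState xs).Bounded B := by
  refine ⟨fun k => ?_, fun k j => ?_⟩
  · change (xs.getD k []).length < 2 ^ B
    rw [List.getD_eq_getElem?_getD]
    rcases hk : xs[k]? with _ | x
    · simp
    · exact h x (List.mem_of_getElem? hk)
  · exact (Bool.toNat_le _).trans_lt (Nat.one_lt_two_pow (by omega))

theorem startState_mem_le (xs : List (List Bool)) (k j : ℕ) : (startState xs).mem k j ≤ 1 :=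
  Bool.toNat_le _

end RAM

open RAM

/-- The number of redundant positions of the code. -/
def redundancy (b t n : ℕ) : ℕ := b + n * (3 * t)

/-- The message that the decoder finds. -/
def decodeList (N b t n ℓ : ℕ) (w : Fin N → Bool) (u : Fin ℓ → Bool) : List Bool :=
  List.ofFn fun j : Fin (N - (1 + redundancy b t n) -
      bitsNum ((startState [List.ofFn w, List.ofFn u]).mem 1) (2 * b + 2 * t) t) =>
    decide (decodeBits N b t n ((startState [List.ofFn w, List.ofFn u]).mem 0)
      ((startState [List.ofFn w, List.ofFn u]).mem 1) j = 1)

theorem sum_range_mul_eq (F : ℕ → ℕ) (b n : ℕ) :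
    ∑ p ∈ Finset.range n, ∑ j ∈ Finset.range b, F (p * b + j) = ∑ j ∈ Finset.range (n * b), F j := by
  induction n with
  | zero => simp
  | succ n ih => rw [Finset.sum_range_succ, ih, add_one_mul, Finset.sum_range_add]

theorem le_card_freeSet_add (b : ℕ) (F : ℕ → ℕ) (p : ℕ) :
    b ≤ (freeSet b F p).card + ∑ j ∈ Finset.range b, F (p * b + j) := by
  rw [freeSet, Finset.card_filter, ← Finset.sum_add_distrib]
  calc b = ∑ j ∈ Finset.range b, 1 := by simp
    _ ≤ _ := Finset.sum_le_sum fun j _ => by split_ifs <;> omega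

/-- The stored bits suffice for the message: the frozen cells, `3 * t` cells per block, and fewer
than `b` cells behind the last block are all that is lost. -/
theorem le_blockChain_snd_of_count {N b t n : ℕ} (hb1 : 1 ≤ b) (hnb : n = N / b) (F : ℕ → ℕ) :
    N - (1 + redundancy b t n) - (∑ j ∈ Finset.range N, F j - 1) ≤
      (blockChain N b t (fun p => (freeSet b F p).card) n).2 := by
  have h1 := le_blockChain_snd (N := N) (b := b) (t := t) (f := fun p => (freeSet b F p).card) n
  have h2 : n * b ≤ ∑ p ∈ Finset.range n, (freeSet b F p).card +
      ∑ j ∈ Finset.range (n * b), F j := by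
    rw [← sum_range_mul_eq, ← Finset.sum_add_distrib]
    calc n * b = ∑ p ∈ Finset.range n, b := by simp
      _ ≤ _ := Finset.sum_le_sum fun p _ => le_card_freeSet_add b F p
  have h3 : n * b ≤ N := hnb ▸ Nat.div_mul_le_self _ _
  have h4 : ∑ j ∈ Finset.range (n * b), F j ≤ ∑ j ∈ Finset.range N, F j :=
    Finset.sum_le_sum_of_subset (Finset.range_mono h3)
  have h5 : N < n * b + b := by
    have := Nat.lt_div_mul_add (a := N) hb1
    rwa [← hnb] at this
  unfold redundancy
  omega

/-- The time that suffices for the encoder. -/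
def encoderTime (q N t b n : ℕ) : ℕ :=
  (2 ^ (2 * b) * (n * (2 ^ b * (3 * b * b + 12 * b + 10) + 7 * b + 22) + 8 * b + 12) +
    4 * N + 15 * t + 24) * ((encoderProg q).weight * (4 * b))

/-- The time that suffices for the decoder. -/
def decoderTime (q N b n : ℕ) : ℕ :=
  (n * (3 * b * b + 11 * b + 15) + 3 * N + 20 * b + 50) * ((decoderProg q).weight * (4 * b))

/-! ### From program runs to the code -/

theorem runsInTime_decoder {q N t b n : ℕ} (htN : t = N.size) (hbt : b = 6 * q * t)
    (hnb : n = N / b) (ht : 1 ≤ t) (hb : 6 * t ≤ b) (w : Fin N → Bool)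
    (u : Fin (2 * b + 3 * t) → Bool) :
    RunsInTime (decoderProg q) [List.ofFn w, List.ofFn u]
      [decodeList N b t n (2 * b + 3 * t) w u] (decoderTime q N b n) := by
  have hNt : N < 2 ^ t := htN ▸ Nat.lt_size_self N
  -- Words of `4 * b` bits hold everything that is stored, including `N < 2 ^ t`, hash values of
  -- fewer than `b` bits and descriptions of `2 * t` bits; the encoder needs them also for the seeds
  -- below `2 ^ (2 * b)`.
  have hBB : 4 * b < 2 ^ (4 * b) := Nat.lt_two_pow_self
  have htb : 2 ^ t ≤ 2 ^ (4 * b) := Nat.pow_le_pow_right (by norm_num) (by omega)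
  set σ := startState [List.ofFn w, List.ofFn u] with hσ
  have hσB : σ.Bounded (4 * b) := by
    refine startState_bounded (by omega) fun x hx => ?_
    simp only [List.mem_cons, List.not_mem_nil, or_false] at hx
    rcases hx with rfl | rfl
    · rw [List.length_ofFn]; omega
    · rw [List.length_ofFn]; omega
  obtain ⟨s, τ, hex, hs, -, h0, hm⟩ := runs_decoderProg (σ := σ) (B := 4 * b)
    (by simp [hσ, startState] : σ.reg 0 = N) htN hbt hnb (by omega) le_rfl (by omega)
    (startState_mem_le _ 0) (startState_mem_le _ 1) (fun _ => rfl) (by omega) hσB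
  refine ⟨s, τ, hex, fun k hk => ?_, by exact_mod_cast hs⟩
  obtain rfl : k = 0 := by simpa using hk
  have hlen : τ.reg 0 = (decodeList N b t n (2 * b + 3 * t) w u).length := by
    rw [h0, decodeList, List.length_ofFn, redundancy, Nat.add_assoc]
  refine ⟨hlen, fun j hj => ?_⟩
  · have hj' : j < (decodeList N b t n (2 * b + 3 * t) w u).length := hj
    rw [hm j (by rw [hlen]; exact hj')]
    change _ = ((decodeList N b t n (2 * b + 3 * t) w u).getD j false).toNat
    rw [decodeList, getD_ofFn_toNat, dif_pos (by simpa [decodeList] using hj')]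
    exact (toNat_decide_eq_one (decodeBits_le ..)).symm

/-- The pair `wu` is read off the final state of the encoding program. The decoder sees the same
hash values, description and count as the program did, since these depend only on cells that are
output. -/
theorem exists_encoding {q N t b n : ℕ} (htN : t = N.size) (hbt : b = 6 * q * t)
    (hnb : n = N / b) (ht : 1 ≤ t) (hb : 6 * t ≤ b) (v : Fin N → Bool) (F : Finset (Fin N))
    (m : List Bool) (hF : m.length = N - (1 + redundancy b t n) - (F.card - 1)) :
    ∃ wu : (Fin N → Bool) × (Fin (2 * b + 3 * t) → Bool),
      RunsInTime (encoderProg q) [List.ofFn v, List.ofFn (fun j : Fin N => decide (j ∈ F)), m]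
        [List.ofFn wu.1, List.ofFn wu.2] (encoderTime q N t b n) ∧
      (∀ j ∈ F, wu.1 j = v j) ∧ decodeList N b t n (2 * b + 3 * t) wu.1 wu.2 = m := by
  have hNt : N < 2 ^ t := htN ▸ Nat.lt_size_self N
  have hBB : 4 * b < 2 ^ (4 * b) := Nat.lt_two_pow_self
  have htb : 2 ^ t ≤ 2 ^ (4 * b) := Nat.pow_le_pow_right (by norm_num) (by omega)
  have hnN : n * b ≤ N := hnb ▸ Nat.div_mul_le_self _ _
  set σ := startState [List.ofFn v, List.ofFn (fun j : Fin N => decide (j ∈ F)), m] with hσ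
  have hσB : σ.Bounded (4 * b) := by
    refine startState_bounded (by omega) fun x hx => ?_
    simp only [List.mem_cons, List.not_mem_nil, or_false] at hx
    rcases hx with rfl | rfl | rfl
    · rw [List.length_ofFn]; omega
    · rw [List.length_ofFn]; omega
    · omega
  have hmem1 : ∀ j, σ.mem 1 j = if h : j < N then (decide (⟨j, h⟩ ∈ F)).toNat else 0 :=
    fun j => getD_ofFn_toNat (fun j : Fin N => decide (j ∈ F)) j
  have hcount : ∑ j ∈ Finset.range N, σ.mem 1 j = F.card := by
    rw [Finset.sum_range]
    simp only [hmem1, Fin.is_lt, dif_pos, Fin.eta]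
    rw [Finset.card_eq_sum_ones, ← Finset.sum_filter_add_sum_filter_not Finset.univ (· ∈ F)]
    rw [Finset.sum_congr rfl (g := fun _ => 1) (fun x hx => by
        simp [(Finset.mem_filter.1 hx).2]),
      Finset.sum_eq_zero (s := Finset.univ.filter fun x => x ∉ F) (fun x hx => by
        simp [(Finset.mem_filter.1 hx).2])]
    simp
  obtain ⟨s, τ, hex, hs, -, hτ⟩ := runs_encoderProg (σ := σ) (B := 4 * b)
    (by simp [hσ, startState] : σ.reg 0 = N) htN hbt hnb ht le_rfl (by omega)
    (startState_mem_le _ 0) (startState_mem_le _ 1) (startState_mem_le _ 2)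
    (fun j hj => by rw [hmem1, dif_neg (by omega)]) (fun _ => rfl) (by omega) hσB
  set w : Fin N → Bool := fun j => decide (τ.mem 0 j = 1) with hw
  set u : Fin (2 * b + 3 * t) → Bool := fun j => decide (τ.mem 1 j = 1) with hu
  have hwm : ∀ j < N, (startState [List.ofFn w, List.ofFn u]).mem 0 j = τ.mem 0 j :=
    fun j hj => by
      refine (getD_ofFn_toNat w j).trans ?_
      rw [dif_pos hj, hw, toNat_decide_eq_one (hτ.mem0_le _)]
  have hum : ∀ j < 2 * b + 3 * t,
      (startState [List.ofFn w, List.ofFn u]).mem 1 j = τ.mem 1 j := fun j hj => by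
    refine (getD_ofFn_toNat u j).trans ?_
    rw [dif_pos hj, hu, toNat_decide_eq_one (hτ.mem1_le _)]
  refine ⟨(w, u), ⟨s, τ, hex, fun k hk => ?_, by exact_mod_cast hs⟩, fun j hj => ?_, ?_⟩
  · have hk : k < 2 := hk
    interval_cases k
    · refine ⟨by simp [hτ.reg0], fun j hj => ?_⟩
      have hj : j < N := by simpa using hj
      exact (hwm j hj).symm
    · refine ⟨by simp [hτ.reg1], fun j hj => ?_⟩
      have hj : j < 2 * b + 3 * t := by simpa using hj
      exact (hum j hj).symm
  · have h1 : σ.mem 1 j ≠ 0 := by rw [hmem1, dif_pos j.2]; simp [hj]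
    have h2 : σ.mem 0 j = (v j).toNat := by
      refine (getD_ofFn_toNat v j).trans ?_
      rw [dif_pos j.2]
    simp only [hw, hτ.mem0 j h1, h2]
    cases v j <;> rfl
  · have hcnt : bitsNum ((startState [List.ofFn w, List.ofFn u]).mem 1) (2 * b + 2 * t) t =
        F.card - 1 := by
      rw [← hcount, ← hτ.count]
      exact bitsNum_congr fun j hj => hum _ (by omega)
    have hdec : ∀ j < m.length, decodeBits N b t n
        ((startState [List.ofFn w, List.ofFn u]).mem 0)
        ((startState [List.ofFn w, List.ofFn u]).mem 1) j = (m.getD j false).toNat := by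
      intro j hj
      refine decodeBits_eq (f := fun p => (freeSet b (σ.mem 1) p).card) (m := σ.mem 2) ht
        (card_freeSet_le b _) hnN hNt (startState_mem_le _ 2) ?_ ?_ ?_
      · intro p hp hft
        rw [← hτ.fit p hp hft]
        have hle := card_freeSet_le b (σ.mem 1) p
        have hpn : (p + 1) * b ≤ N := (Nat.mul_le_mul_right _ hp).trans hnN
        rw [add_one_mul] at hpn
        exact hashNum_congr (by omega) (fun j hj => hwm _ (by omega)) fun j hj => hum _ (by omega)
      · rw [← hτ.chain]
        exact bitsNum_congr fun j hj => hum _ (by omega)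
      -- The list may hold more bits than the message has; the surplus is padding by the zeros
      -- behind the message in array `2`.
      · refine lt_of_lt_of_le hj ?_
        rw [hF, ← hcount]
        exact le_blockChain_snd_of_count (by omega) hnb _
    refine List.ext_getElem ?_ fun j hj hj' => ?_
    · simp only [decodeList, List.length_ofFn]
      rw [hcnt, hF]
    · simp only [decodeList, List.getElem_ofFn]
      rw [hdec j hj', List.getD_eq_getElem _ _ hj']
      cases m[j] <;> rfl

/-- The bit strings of length `k`. -/
def bitStrings (k : ℕ) : Finset (List Bool) :=
  (Finset.univ : Finset (Fin k → Bool)).image List.ofFn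

theorem mem_bitStrings {k : ℕ} {m : List Bool} : m ∈ bitStrings k ↔ m.length = k := by
  simp only [bitStrings, Finset.mem_image, Finset.mem_univ, true_and]
  constructor
  · rintro ⟨v, rfl⟩
    exact List.length_ofFn
  · rintro rfl
    exact ⟨m.get, List.ofFn_get m⟩

theorem card_bitStrings (k : ℕ) : (bitStrings k).card = 2 ^ k := by
  rw [bitStrings, Finset.card_image_of_injective _ List.ofFn_injective, Finset.card_univ,
    Fintype.card_fun, Fintype.card_fin, Fintype.card_bool]

theorem exists_code {q N t b n : ℕ} (htN : t = N.size) (hbt : b = 6 * q * t)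
    (hnb : n = N / b) (ht : 1 ≤ t) (hb : 6 * t ≤ b) :
    ∃ c : StrongStuckAtCode (List Bool) N (2 * b + 3 * t),
      (∀ i, c.msg i = bitStrings (N - (1 + redundancy b t n) - ((i : ℕ) - 1))) ∧
      c.EncodedBy (encoderProg q) (encoderTime q N t b n) ∧
      c.DecodedBy (decoderProg q) (decoderTime q N b n) := by
  have hN : 1 ≤ N := by
    by_contra h
    obtain rfl : N = 0 := by omega
    simp at htN
    omega
  have hen := fun v (F : Finset (Fin N)) m hF =>
    exists_encoding (q := q) htN hbt hnb ht hb v F m hF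
  -- The encoder of the code is, by choice, an output of the encoding program.
  choose enc henc using hen
  refine ⟨{
    msg := fun i => bitStrings (N - (1 + redundancy b t n) - ((i : ℕ) - 1))
    enc := fun i v F m => enc v F.1 m.1 (by rw [F.2]; exact mem_bitStrings.1 m.2)
    dec := fun w u => ⟨decodeList N b t n (2 * b + 3 * t) w u, ?_⟩
    consistent := fun i v F m => (henc v F.1 m.1 _).2.1
    decodable := fun i v F m => (henc v F.1 m.1 _).2.2 }, fun _ => rfl, ?_, ?_⟩
  -- The decoder is total, so every transmitted count `x` must give a legal message length. Sending
  -- the number of frozen cells minus one makes `x = 0` legal; for `x ≥ N` the truncated length is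
  -- zero, the same as for `N` frozen cells.
  · set x := bitsNum ((startState [List.ofFn w, List.ofFn u]).mem 1) (2 * b + 2 * t) t with hx
    refine ⟨⟨1 + min x (N - 1), Finset.mem_Icc.2 ⟨by omega, by omega⟩⟩, mem_bitStrings.2 ?_⟩
    simp only [decodeList, List.length_ofFn, ← hx]
    omega
  · exact fun i v F m => (henc v F.1 m.1 _).1
  · exact fun w u => runsInTime_decoder htN hbt hnb ht hb w u

/-! ### Asymptotics -/

open RAM

theorem encoderTime_le {q N t b n : ℕ} (hN : 1 ≤ N) (htb : t ≤ b) (hb : 6 ≤ b) (hn : n ≤ N) :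
    encoderTime q N t b n ≤ 2 ^ (3 * b) * N * (48 * (encoderProg q).weight * b ^ 3) := by
  have hP : 1 ≤ 2 ^ b := Nat.one_le_two_pow
  have hP2 : 1 ≤ 2 ^ (2 * b) := Nat.one_le_two_pow
  have h3 : 2 ^ (3 * b) = 2 ^ (2 * b) * 2 ^ b := by rw [← pow_add]; congr 1; ring
  -- All terms are raised to the common factor `P2 * P * N`, so that the step count becomes `2 ^ (3
  -- * b) * N` times a polynomial in `b`.
  have key : ∀ {P P2 X Y Z R : ℕ}, 1 ≤ P → 1 ≤ P2 →
      P2 * (n * (P * X + Y) + Z) + R * N ≤ P2 * P * N * (X + Y + Z + R) := by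
    intro P P2 X Y Z R h1 h2
    have hY : Y ≤ P * Y := Nat.le_mul_of_pos_left _ h1
    have hZ : Z ≤ N * P * Z := Nat.le_mul_of_pos_left _ (Nat.mul_pos hN h1)
    have hR : R * N ≤ P2 * P * (R * N) := Nat.le_mul_of_pos_left _ (Nat.mul_pos h2 h1)
    calc P2 * (n * (P * X + Y) + Z) + R * N
        ≤ P2 * (N * (P * X + P * Y) + N * P * Z) + P2 * P * (R * N) := by gcongr
      _ = P2 * P * N * (X + Y + Z + R) := by ring
  have hsteps : 2 ^ (2 * b) * (n * (2 ^ b * (3 * b * b + 12 * b + 10) + 7 * b + 22) + 8 * b + 12) +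
      4 * N + 15 * t + 24 ≤ 2 ^ (3 * b) * N * (12 * b ^ 2) := by
    have h4 : 15 * t + 24 ≤ (15 * b + 24) * N :=
      (by omega : 15 * t + 24 ≤ 15 * b + 24).trans (Nat.le_mul_of_pos_right _ hN)
    have h5 := key (X := 3 * b * b + 12 * b + 10) (Y := 7 * b + 22) (Z := 8 * b + 12)
      (R := 15 * b + 28) hP hP2
    have h6 : 3 * b * b + 12 * b + 10 + (7 * b + 22) + (8 * b + 12) + (15 * b + 28) ≤
        12 * b ^ 2 := by nlinarith
    rw [h3]
    refine le_trans ?_ (h5.trans (Nat.mul_le_mul_left _ h6))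
    have h7 : (15 * b + 28) * N = (15 * b + 24) * N + 4 * N := by ring
    rw [h7]
    simp only [← add_assoc] at h4 ⊢
    omega
  unfold encoderTime
  calc _ ≤ 2 ^ (3 * b) * N * (12 * b ^ 2) * ((encoderProg q).weight * (4 * b)) :=
        Nat.mul_le_mul_right _ hsteps
    _ = _ := by ring

theorem decoderTime_le {q N b n : ℕ} (hN : 1 ≤ N) (hb : 6 ≤ b) (hn : n ≤ N) :
    decoderTime q N b n ≤ 44 * (decoderProg q).weight * (N * b ^ 3) := by
  have hsteps : n * (3 * b * b + 11 * b + 15) + 3 * N + 20 * b + 50 ≤ N * (11 * b ^ 2) := by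
    have h1 : n * (3 * b * b + 11 * b + 15) ≤ N * (3 * b * b + 11 * b + 15) :=
      Nat.mul_le_mul_right _ hn
    have h2 : 20 * b + 50 ≤ N * (20 * b + 50) := Nat.le_mul_of_pos_left _ hN
    have h3 : 3 * b * b + 11 * b + 15 + 3 + (20 * b + 50) ≤ 11 * b ^ 2 := by nlinarith
    have h4 := Nat.mul_le_mul_left N h3
    have h5 : N * (3 * b * b + 11 * b + 15 + 3 + (20 * b + 50)) =
      N * (3 * b * b + 11 * b + 15) + 3 * N + N * (20 * b + 50) := by ring
    omega
  unfold decoderTime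
  calc _ ≤ N * (11 * b ^ 2) * ((decoderProg q).weight * (4 * b)) := Nat.mul_le_mul_right _ hsteps
    _ = _ := by ring

theorem eventually_le_logb (c : ℝ) : ∀ᶠ N : ℕ in Filter.atTop, c ≤ Real.logb 2 N :=
  ((Real.tendsto_logb_atTop one_lt_two).comp tendsto_natCast_atTop_atTop).eventually_ge_atTop c

/-- Powers of the logarithm are `o(N)`; this absorbs every factor that depends on `ε`. -/
theorem eventually_mul_logb_pow_le (c : ℝ) (k : ℕ) :
    ∀ᶠ N : ℕ in Filter.atTop, c * Real.logb 2 N ^ k ≤ N := by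
  have h1 : (fun x : ℝ => c / Real.log 2 ^ k * Real.log x ^ k) =o[Filter.atTop] (id : ℝ → ℝ) :=
    (Real.isLittleO_pow_log_id_atTop (n := k)).const_mul_left _
  have h2 := (h1.bound one_pos).natCast_atTop
  filter_upwards [h2] with N hN
  rw [one_mul, id, Real.norm_natCast] at hN
  refine le_trans (le_of_eq ?_) ((le_abs_self _).trans hN)
  rw [Real.logb, div_pow]
  ring

theorem natSize_le_two_mul_logb {N : ℕ} (hN : 2 ≤ N) : (N.size : ℝ) ≤ 2 * Real.logb 2 N := by
  have h1 : 1 ≤ N.size := Nat.size_pos.2 (by omega)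
  have h2 : 2 ^ (N.size - 1) ≤ N := Nat.lt_size.1 (by omega)
  have hN' : (2 : ℝ) ≤ N := by exact_mod_cast hN
  have h3 : ((N.size - 1 : ℕ) : ℝ) ≤ Real.logb 2 N := by
    rw [Real.le_logb_iff_rpow_le one_lt_two (by linarith), Real.rpow_natCast]
    exact_mod_cast h2
  have h4 : (1 : ℝ) ≤ Real.logb 2 N := by
    rw [Real.le_logb_iff_rpow_le one_lt_two (by linarith), Real.rpow_one]
    exact hN'
  push_cast [h1] at h3
  linarith

theorem StrongStuckAtCode.isGapped_of_card {N ℓ e : ℕ} {ε : ℝ} (hN : 1 ≤ N)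
    (c : StrongStuckAtCode (List Bool) N ℓ) (he : (e : ℝ) ≤ ε * N)
    (hc : ∀ i, (c.msg i).card = 2 ^ (N - (1 + e) - ((i : ℕ) - 1))) : c.IsGapped ε := by
  intro ρ _ _ i hi
  have hN0 : (0 : ℝ) < N := by exact_mod_cast hN
  have hi1 : 1 ≤ (i : ℕ) := (Finset.mem_Icc.1 i.2).1
  rw [StrongStuckAtCode.rate, hc, le_div_iff₀ hN0]
  push_cast
  rw [Real.logb_pow, Real.logb_self_eq_one one_lt_two, mul_one]
  have h1 : (N : ℝ) ≤ ((N - (1 + e) - ((i : ℕ) - 1) : ℕ) : ℝ) + e + (i : ℕ) := by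
    exact_mod_cast (by omega : N ≤ (N - (1 + e) - ((i : ℕ) - 1)) + e + i)
  rw [hi] at h1
  nlinarith

theorem theorem5 :
    ∃ (K A L : ℝ) (d : ℕ), ∀ ε : ℝ, 0 < ε → ε < 1 →
      ∃ (N₀ : ℕ) (encoder decoder : RAM.Prog), ∀ N : ℕ, N₀ < N →
        ∃ (ℓ : ℕ) (c : StrongStuckAtCode (List Bool) N ℓ),
          c.IsGapped ε ∧
          (∀ i, ∃ k : ℕ, ∀ m : List Bool, m ∈ c.msg i ↔ m.length = k) ∧
          (ℓ : ℝ) ≤ K * (1 / ε) * Real.logb 2 N ∧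
          c.EncodedBy encoder ((N : ℝ) ^ (A * (1 / ε))) ∧
          c.DecodedBy decoder (L * N * Real.logb 2 N ^ d) := by
  -- With `q ≤ 2 / ε` and `t ≤ 2 * log N`, the side information has at most `15 * q * t ≤ 60 / ε *
  -- log N` bits, and the exponent `36 * q + 2` of the encoder is at most `74 / ε`. The decoder
  -- needs `log^3 N` times a constant depending on `ε`, which a fourth logarithm swallows; hence `L
  -- = 1` and `d = 4`.
  refine ⟨60, 74, 1, 4, fun ε hε hε1 => ?_⟩
  set q : ℕ := ⌈1 / ε⌉₊ with hq
  have h1ε : 1 < 1 / ε := by rwa [lt_div_iff₀ hε, one_mul]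
  have hq1 : 1 ≤ q := Nat.one_le_ceil_iff.2 (by linarith)
  have hqle : 1 / ε ≤ q := Nat.le_ceil _
  have hqlt : (q : ℝ) ≤ 2 * (1 / ε) := by
    have := Nat.ceil_lt_add_one (by linarith : 0 ≤ 1 / ε)
    linarith
  -- Besides `2 ≤ N`, these say that one block is at most `N / (2 * q)` long, that the polynomial
  -- overhead of the encoder is at most `N`, and that the constant of the decoder is at most `log
  -- N`.
  have hev : ∀ᶠ N : ℕ in Filter.atTop, 2 ≤ N ∧
      2 * q * (12 * q) * Real.logb 2 N ^ 1 ≤ N ∧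
      48 * (encoderProg q).weight * (12 * q) ^ 3 * Real.logb 2 N ^ 3 ≤ N ∧
      44 * (decoderProg q).weight * (12 * q) ^ 3 ≤ Real.logb 2 N :=
    (Filter.eventually_ge_atTop 2).and ((eventually_mul_logb_pow_le _ _).and
      ((eventually_mul_logb_pow_le _ _).and (eventually_le_logb _)))
  obtain ⟨N₀, hN₀⟩ := Filter.eventually_atTop.1 hev
  refine ⟨N₀, encoderProg q, decoderProg q, fun N hN => ?_⟩
  obtain ⟨hN2, hE1, hE2, hE3⟩ := hN₀ N hN.le
  obtain ⟨t, htN⟩ : ∃ t, t = N.size := ⟨_, rfl⟩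
  obtain ⟨b, hbt⟩ : ∃ b, b = 6 * q * t := ⟨_, rfl⟩
  obtain ⟨n, hnb⟩ : ∃ n, n = N / b := ⟨_, rfl⟩
  have ht : 1 ≤ t := htN ▸ Nat.size_pos.2 (by omega)
  have hb : 6 * t ≤ b := by rw [hbt]; nlinarith
  have hnN : n ≤ N := hnb ▸ Nat.div_le_self _ _
  have hnbN : n * b ≤ N := hnb ▸ Nat.div_mul_le_self _ _
  have hNpos : (0 : ℝ) < N := by exact_mod_cast (by omega : 0 < N)
  have hlog : (1 : ℝ) ≤ Real.logb 2 N := by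
    rw [Real.le_logb_iff_rpow_le one_lt_two hNpos, Real.rpow_one]
    exact_mod_cast hN2
  have htlog : (t : ℝ) ≤ 2 * Real.logb 2 N := htN ▸ natSize_le_two_mul_logb hN2
  have hblog : (b : ℝ) ≤ 12 * q * Real.logb 2 N := by
    rw [hbt]
    push_cast
    nlinarith
  have hb3 : (b : ℝ) ^ 3 ≤ (12 * q) ^ 3 * Real.logb 2 N ^ 3 := by
    rw [← mul_pow]
    gcongr
  obtain ⟨c, hmsg, henc, hdec⟩ := exists_code htN hbt hnb ht hb
  refine ⟨2 * b + 3 * t, c, ?_, fun i =>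
    ⟨N - (1 + redundancy b t n) - ((i : ℕ) - 1), fun m => ?_⟩, ?_, ?_, ?_⟩
  · refine c.isGapped_of_card (e := redundancy b t n) (by omega) ?_ fun i => by
      rw [hmsg, card_bitStrings]
    -- The factor `6` in `b = 6 * q * t` is chosen for this: the losses inside the blocks sum to at
    -- most `N / (2 * q)`, and the cells outside the blocks take the other half of `N / q ≤ ε * N`.
    have h1 : (n * (3 * t) * (2 * q) : ℝ) ≤ N := by
      have : n * (3 * t) * (2 * q) = n * b := by rw [hbt]; ring
      exact_mod_cast this.trans_le hnbN
    have h2 : (b : ℝ) * (2 * q) ≤ N := by nlinarith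
    have h3 : 1 ≤ ε * q := by
      have := mul_le_mul_of_nonneg_left hqle hε.le
      rwa [mul_one_div_cancel hε.ne'] at this
    unfold redundancy
    push_cast
    have h4 : ((b : ℝ) + n * (3 * t)) * q ≤ N := by linarith
    have h5 : (0 : ℝ) ≤ b + n * (3 * t) := by positivity
    nlinarith
  · rw [hmsg, mem_bitStrings]
  · push_cast
    have h1 : (2 * b + 3 * t : ℝ) ≤ 15 * q * t := by
      have : 2 * b + 3 * t ≤ 15 * q * t := by rw [hbt]; nlinarith
      exact_mod_cast this
    have h2 : (q : ℝ) * t ≤ 2 * (1 / ε) * (2 * Real.logb 2 N) := by gcongr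
    linarith
  · have htime : (encoderTime q N t b n : ℝ) ≤ (N : ℝ) ^ (74 * (1 / ε)) := by
      have h1 : (encoderTime q N t b n : ℝ) ≤
          2 ^ (3 * b) * N * (48 * (encoderProg q).weight * b ^ 3) := by
        exact_mod_cast encoderTime_le (by omega) (by omega) (by omega) hnN
      have h2 : (48 * (encoderProg q).weight * b ^ 3 : ℝ) ≤ N := by
        refine le_trans ?_ hE2
        rw [mul_assoc _ _ (Real.logb 2 N ^ 3)]
        gcongr
      have h3 : (2 : ℝ) ^ (3 * b) ≤ N ^ (36 * q) := by
        -- Since `2 ^ t ≤ 2 * N` and `2 ≤ N`.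
        have h4 : 2 ^ t ≤ N ^ 2 := by
          have h5 : 2 ^ (t - 1) ≤ N := Nat.lt_size.1 (by omega)
          have h6 : 2 ^ t = 2 ^ (t - 1) * 2 := by rw [← pow_succ]; congr 1; omega
          rw [h6, sq]
          exact Nat.mul_le_mul h5 hN2
        have h7 : 2 ^ (3 * b) ≤ N ^ (36 * q) :=
          calc 2 ^ (3 * b) = (2 ^ t) ^ (18 * q) := by rw [← pow_mul, hbt]; congr 1; ring
            _ ≤ (N ^ 2) ^ (18 * q) := Nat.pow_le_pow_left h4 _
            _ = N ^ (36 * q) := by rw [← pow_mul]; congr 1; ring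
        exact_mod_cast h7
      calc (encoderTime q N t b n : ℝ)
          ≤ N ^ (36 * q) * N * N := h1.trans (by gcongr)
        _ = (N : ℝ) ^ (36 * q + 2) := by ring
        _ = (N : ℝ) ^ (((36 * q + 2 : ℕ) : ℝ)) := (Real.rpow_natCast _ _).symm
        _ ≤ (N : ℝ) ^ (74 * (1 / ε)) := by
          refine Real.rpow_le_rpow_of_exponent_le (by exact_mod_cast (by omega : 1 ≤ N)) ?_
          push_cast
          linarith
    intro i v F m
    obtain ⟨s, τ, hex, hshow, hs⟩ := henc i v F m
    exact ⟨s, τ, hex, hshow, hs.trans htime⟩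
  · have htime : (decoderTime q N b n : ℝ) ≤ 1 * N * Real.logb 2 N ^ 4 := by
      have h1 : (decoderTime q N b n : ℝ) ≤ 44 * (decoderProg q).weight * (N * b ^ 3) := by
        exact_mod_cast decoderTime_le (by omega) (by omega) hnN
      calc (decoderTime q N b n : ℝ)
          ≤ 44 * (decoderProg q).weight * (N * ((12 * q) ^ 3 * Real.logb 2 N ^ 3)) :=
            h1.trans (by gcongr)
        _ = 44 * (decoderProg q).weight * (12 * q) ^ 3 * (N * Real.logb 2 N ^ 3) := by ring
        _ ≤ Real.logb 2 N * (N * Real.logb 2 N ^ 3) := by gcongr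
        _ = 1 * N * Real.logb 2 N ^ 4 := by ring
    intro w u
    obtain ⟨s, τ, hex, hshow, hs⟩ := hdec w u
    exact ⟨s, τ, hex, hshow, hs.trans htime⟩
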